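/- Let $r\ge 0$, $s\ge 1$ and $n_0,\dots,n_{s-1}\ge 0$ be integers, $W=\mathbb C^r$ with standard basis $w_1,\dots,w_r$, and $V_i=\mathbb C^{n_i}$. Consider the framed quiver representations $X=(B_1^i,B_2^i,I,J,F^i)$ with $B_1^i,B_2^i\in\operatorname{End}(V_i)$ $(0\le i\le s-1)$, $I\in\operatorname{Hom}(W,V_0)$, $J\in\operatorname{Hom}(V_0,W)$, $F^i\in\operatorname{Hom}(V_i,V_{i-1})$ $(1\le i\le s-1)$, subject to the relations $$[B_1^0,B_2^0]+IJ=0,\qquad [B_1^i,B_2^i]=0,\qquad B_l^{i-1}F^i=F^iB_l^i,\qquad JF^1=0\qquad(1\le i\le s-1,\ l=1,2).$$ For $\theta\in\mathbb R^s$ and a family $S=(S_i)$ of subspaces $S_i\subseteq V_i$ put $\theta(S)=\sum_i\theta_i\dim S_i$. The representation $X$ is $\theta$-stable if, for every family $S$ preserved by all $B_l^i$ and $F^i$: if $S\neq 0$ and $S_0\subseteq\ker J$ then $\theta(S)<0$; if $S\ne V$ and $\operatorname{im} I\subseteq S_0$ then $\theta(S)<\theta(V)$. Fix $\theta$ in the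 chamber $\theta_i>0$ for $i>0$, $\theta_0+\sum_{i>0}n_i\theta_i<0$. Let $\mathcal N(r,n_0,\dots,n_{s-1})$ be the moduli space of $\theta$-stable representations, that is, the quotient of the space of $\theta$-stable representations satisfying the relations by $\prod_iGL(V_i)$, with the quotient of the Euclidean topology. The torus $T=(\mathbb C^*)^2\times(\mathbb C^*)^r\ni(t_1,t_2,R)$ acts on it by $$(B_1^i,B_2^i,I,J,F^i)\mapsto(t_1B_1^i,\;t_2B_2^i,\;IR^{-1},\;t_1t_2RJ,\;F^i),$$ where $R$ is regarded as a diagonal matrix in $GL(W)$. **Proposition.** The fixed locus $\mathcal N(r,n_0,\dots,n_{s-1})^T$ is finite and discrete, i.e. consists of finitely many isolated points, and it coincides with the fixed locus of the compact torus $U(1)^{r+2}\subset T$. It is in bijection with the set of $s$-tuples of nested $r$-coloured partitions ($r$-tuples of Young diagrams, ordered by componentwise inclusion) $$\boldsymbol\mu_1\subseteq\cdots\subseteq\boldsymbol\mu_{s-1}\subseteq\boldsymbol\mu_0,\qquad |\boldsymbol\mu_0|=n_0,\qquad |\boldsymbol\mu_i|=n_0-n_i\ \ (i>0).$$ The bijection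 sends the class of $X$ to the tuple in which, with boxes indexed by $(p,q)\in\mathbb Z_{\ge0}^2$, the box $(p,q)$ belongs to the $a$-th component of $\boldsymbol\mu_0$ if and only if $(B_1^0)^p(B_2^0)^qI(w_a)\ne0$, and, for $i>0$, to the $a$-th component of $\boldsymbol\mu_i$ if and only if $(B_1^0)^p(B_2^0)^qI(w_a)\notin\operatorname{im}(F^1F^2\cdots F^i)$. -/

import Mathlib

open scoped Matrix

noncomputable section

namespace NestedInstanton

/-- Framed representations of the nested instanton quiver with `s = m + 1` gauge nodes, on
`W = ℂ ^ r` and `V i = ℂ ^ (n i)` for `i = 0, …, m`.  The arrow `F i` goes from `V (i + 1)` to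
`V i`; in the usual numbering of the arrows it is the one with index `i + 1`. -/
@[ext]
structure Rep (r : ℕ) {m : ℕ} (n : Fin (m + 1) → ℕ) where
  B₁ : ∀ i, Matrix (Fin (n i)) (Fin (n i)) ℂ
  B₂ : ∀ i, Matrix (Fin (n i)) (Fin (n i)) ℂ
  I : Matrix (Fin (n 0)) (Fin r) ℂ
  J : Matrix (Fin r) (Fin (n 0)) ℂ
  F : ∀ i : Fin m, Matrix (Fin (n i.castSucc)) (Fin (n i.succ)) ℂ

/-- The gauge group `GL(V 0) × ⋯ × GL(V m)`. -/
abbrev Gauge {m : ℕ} (n : Fin (m + 1) → ℕ) := ∀ i, Matrix.GeneralLinearGroup (Fin (n i)) ℂ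

/-- The algebraic torus `(ℂˣ)² × (ℂˣ) ^ r`: the first factor rescales `B₁` and `B₂`, the second is
the diagonal torus of `GL(W)`. -/
abbrev Torus (r : ℕ) := (ℂˣ × ℂˣ) × (Fin r → ℂˣ)

/-- The compact torus `U(1) ^ (r + 2)` inside `Torus r`. -/
def compactTorus (r : ℕ) : Subgroup (Torus r) where
  carrier := {t | ‖(t.1.1 : ℂ)‖ = 1 ∧ ‖(t.1.2 : ℂ)‖ = 1 ∧ ∀ a, ‖(t.2 a : ℂ)‖ = 1}
  one_mem' := by simp
  mul_mem' := by
    rintro s t ⟨h1, h2, h3⟩ ⟨k1, k2, k3⟩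
    simp [h1, h2, h3, k1, k2, k3]
  inv_mem' := by
    rintro s ⟨h1, h2, h3⟩
    simp [h1, h2, h3]

variable {r m : ℕ} {n : Fin (m + 1) → ℕ}

namespace Rep

/-- The entries of all the matrices of a representation. -/
def entries (X : Rep r n) :
    (∀ i, Matrix (Fin (n i)) (Fin (n i)) ℂ) × (∀ i, Matrix (Fin (n i)) (Fin (n i)) ℂ) ×
      Matrix (Fin (n 0)) (Fin r) ℂ × Matrix (Fin r) (Fin (n 0)) ℂ ×
      (∀ i : Fin m, Matrix (Fin (n i.castSucc)) (Fin (n i.succ)) ℂ) :=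
  (X.B₁, X.B₂, X.I, X.J, X.F)

/-- The usual topology of the finite dimensional complex vector space of representations. -/
instance : TopologicalSpace (Rep r n) := TopologicalSpace.induced entries inferInstance

/-- The relations of the quiver. -/
structure Relations (X : Rep r n) : Prop where
  adhm : X.B₁ 0 * X.B₂ 0 - X.B₂ 0 * X.B₁ 0 + X.I * X.J = 0
  comm : ∀ i : Fin m, X.B₁ i.succ * X.B₂ i.succ - X.B₂ i.succ * X.B₁ i.succ = 0
  b₁F : ∀ i : Fin m, X.B₁ i.castSucc * X.F i - X.F i * X.B₁ i.succ = 0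
  b₂F : ∀ i : Fin m, X.B₂ i.castSucc * X.F i - X.F i * X.B₂ i.succ = 0
  jF : ∀ (h : 0 < m) (v : Fin (n (Fin.succ ⟨0, h⟩)) → ℂ), X.J *ᵥ (X.F ⟨0, h⟩ *ᵥ v) = 0

/-- Families of subspaces of the `V i` that are preserved by all the arrows between gauge nodes. -/
structure IsInvariant (X : Rep r n) (S : ∀ i, Submodule ℂ (Fin (n i) → ℂ)) : Prop where
  b₁ : ∀ i, ∀ v ∈ S i, X.B₁ i *ᵥ v ∈ S i
  b₂ : ∀ i, ∀ v ∈ S i, X.B₂ i *ᵥ v ∈ S i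
  f : ∀ i : Fin m, ∀ v ∈ S i.succ, X.F i *ᵥ v ∈ S i.castSucc

/-- The value of the stability parameter `θ` on the dimension vector of a family of subspaces. -/
def slope (θ : Fin (m + 1) → ℝ) (S : ∀ i, Submodule ℂ (Fin (n i) → ℂ)) : ℝ :=
  ∑ i, θ i * (Module.finrank ℂ (S i) : ℝ)

/-- `θ`-stability of a framed representation: an invariant family `S ≠ 0` with `S 0 ⊆ ker J`
(a subrepresentation with framing `0`) has `θ(dim S) < 0`, and an invariant family `S ≠ V` with
`im I ⊆ S 0` (a subrepresentation with framing `W`) has `θ(dim S) < θ(dim V)`. -/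
structure IsStable (θ : Fin (m + 1) → ℝ) (X : Rep r n) : Prop where
  of_le_ker : ∀ S, X.IsInvariant S → (∀ v ∈ S 0, X.J *ᵥ v = 0) → S ≠ (fun _ => ⊥) →
    slope θ S < 0
  of_range_le : ∀ S, X.IsInvariant S → (∀ w, X.I *ᵥ w ∈ S 0) → S ≠ (fun _ => ⊤) →
    slope θ S < ∑ i, θ i * (n i : ℝ)

/-- Change of bases in the spaces `V i`. -/
@[simps]
def gaugeAct (g : Gauge n) (X : Rep r n) : Rep r n where
  B₁ i := (g i).val * X.B₁ i * (g i)⁻¹.val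
  B₂ i := (g i).val * X.B₂ i * (g i)⁻¹.val
  I := (g 0).val * X.I
  J := X.J * (g 0)⁻¹.val
  F i := (g i.castSucc).val * X.F i * (g i.succ)⁻¹.val

instance : MulAction (Gauge n) (Rep r n) where
  smul := gaugeAct
  one_smul X := by
    change gaugeAct _ _ = _
    ext <;> simp
  mul_smul g h X := by
    change gaugeAct _ _ = gaugeAct _ (gaugeAct _ _)
    apply Rep.ext <;> (try funext i) <;>
      simp only [gaugeAct, Pi.mul_apply, mul_inv_rev, Units.val_mul, Matrix.mul_assoc]

/-- The torus action: `(t₁, t₂, R)` sends `(B₁, B₂, I, J, F)` to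
`(t₁ B₁, t₂ B₂, I R⁻¹, t₁ t₂ R J, F)`. -/
@[simps]
def torusAct (t : Torus r) (X : Rep r n) : Rep r n where
  B₁ i := (t.1.1 : ℂ) • X.B₁ i
  B₂ i := (t.1.2 : ℂ) • X.B₂ i
  I := X.I * Matrix.diagonal fun a => (t.2 a : ℂ)⁻¹
  J := ((t.1.1 : ℂ) * (t.1.2 : ℂ)) • (Matrix.diagonal (fun a => (t.2 a : ℂ)) * X.J)
  F i := X.F i

instance : MulAction (Torus r) (Rep r n) where
  smul := torusAct
  one_smul X := by
    change torusAct _ _ = _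
    ext <;> simp
  mul_smul s t X := by
    change torusAct _ _ = torusAct _ (torusAct _ _)
    apply Rep.ext
    · funext i; simp [mul_smul]
    · funext i; simp [mul_smul]
    · ext; simp; ring
    · ext; simp; ring
    · rfl

theorem gauge_smul_def (g : Gauge n) (X : Rep r n) : g • X = gaugeAct g X := rfl

theorem torus_smul_def (t : Torus r) (X : Rep r n) : t • X = torusAct t X := rfl

instance : SMulCommClass (Torus r) (Gauge n) (Rep r n) where
  smul_comm t g X := by
    simp only [gauge_smul_def, torus_smul_def]
    apply Rep.ext
    · funext i; simp
    · funext i; simp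
    · simp [Matrix.mul_assoc]
    · simp [Matrix.mul_assoc]
    · rfl

theorem Relations.torus_smul {X : Rep r n} (hX : X.Relations) (t : Torus r) :
    (t • X).Relations := by
  rw [torus_smul_def]
  have hIJ : (torusAct t X).I * (torusAct t X).J =
      ((t.1.1 : ℂ) * (t.1.2 : ℂ)) • (X.I * X.J) := by
    have hd : (Matrix.diagonal fun a => (t.2 a : ℂ)⁻¹) * Matrix.diagonal (fun a => (t.2 a : ℂ)) =
        1 := by
      rw [Matrix.diagonal_mul_diagonal]; simp
    simp only [torusAct, Matrix.mul_smul]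
    rw [Matrix.mul_assoc, ← Matrix.mul_assoc (Matrix.diagonal _), hd, Matrix.one_mul]
  have hB : ∀ i, (torusAct t X).B₁ i * (torusAct t X).B₂ i -
      (torusAct t X).B₂ i * (torusAct t X).B₁ i =
      ((t.1.1 : ℂ) * (t.1.2 : ℂ)) • (X.B₁ i * X.B₂ i - X.B₂ i * X.B₁ i) := fun i => by
    simp only [torusAct, Matrix.mul_smul, Matrix.smul_mul, smul_smul, smul_sub,
      mul_comm (t.1.2 : ℂ)]
  refine ⟨?_, fun i => ?_, fun i => ?_, fun i => ?_, fun h v => ?_⟩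
  · rw [hIJ, hB, ← smul_add, hX.adhm, smul_zero]
  · rw [hB, hX.comm, smul_zero]
  · simp only [torusAct, Matrix.mul_smul, Matrix.smul_mul]
    rw [← smul_sub, hX.b₁F, smul_zero]
  · simp only [torusAct, Matrix.mul_smul, Matrix.smul_mul]
    rw [← smul_sub, hX.b₂F, smul_zero]
  · have := hX.jF h v
    change ((_ : ℂ) • (_ * X.J)) *ᵥ _ = 0
    rw [Matrix.smul_mulVec, ← Matrix.mulVec_mulVec]
    change _ • _ *ᵥ (X.J *ᵥ (X.F ⟨0, h⟩ *ᵥ v)) = 0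
    rw [this]; simp

theorem IsInvariant.of_torus_smul {X : Rep r n} {t : Torus r}
    {S : ∀ i, Submodule ℂ (Fin (n i) → ℂ)} (h : (t • X).IsInvariant S) : X.IsInvariant S where
  b₁ i v hv := by
    have := h.b₁ i v hv
    rwa [torus_smul_def, torusAct_B₁, Matrix.smul_mulVec,
      Submodule.smul_mem_iff _ t.1.1.ne_zero] at this
  b₂ i v hv := by
    have := h.b₂ i v hv
    rwa [torus_smul_def, torusAct_B₂, Matrix.smul_mulVec,
      Submodule.smul_mem_iff _ t.1.2.ne_zero] at this
  f i v hv := h.f i v hv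

theorem IsStable.torus_smul {θ : Fin (m + 1) → ℝ} {X : Rep r n} (hX : X.IsStable θ)
    (t : Torus r) : (t • X).IsStable θ where
  of_le_ker S hS hJ h0 := by
    refine hX.of_le_ker S hS.of_torus_smul (fun v hv => ?_) h0
    have := hJ v hv
    rw [torus_smul_def, torusAct_J, Matrix.smul_mulVec,
      smul_eq_zero_iff_right (mul_ne_zero t.1.1.ne_zero t.1.2.ne_zero),
      ← Matrix.mulVec_mulVec] at this
    funext a
    have h1 := congrFun this a
    rw [Matrix.mulVec_diagonal] at h1
    simpa using h1
  of_range_le S hS hI h0 := by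
    refine hX.of_range_le S hS.of_torus_smul (fun w => ?_) h0
    have := hI (fun a => (t.2 a : ℂ) * w a)
    have hw : (Matrix.diagonal fun a => (t.2 a : ℂ)⁻¹) *ᵥ (fun a => (t.2 a : ℂ) * w a) = w := by
      funext a
      rw [Matrix.mulVec_diagonal]
      simp
    rwa [torus_smul_def, torusAct_I, ← Matrix.mulVec_mulVec, hw] at this

/-- The composition `V k → V (k - 1) → ⋯ → V 0` of the arrows `F`. -/
def toV₀ (X : Rep r n) (k : Fin (m + 1)) : Matrix (Fin (n 0)) (Fin (n k)) ℂ :=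
  Fin.induction (motive := fun k => Matrix (Fin (n 0)) (Fin (n k)) ℂ) 1
    (fun i A => A * X.F i) k

/-- The subspace of `V 0` by which one divides to get the `k`-th ADHM datum: `0` for `k = 0`,
the image of `V k` for `k > 0`. -/
def imageInV₀ (X : Rep r n) (k : Fin (m + 1)) : Submodule ℂ (Fin (n 0) → ℂ) :=
  if k = 0 then ⊥ else LinearMap.range (X.toV₀ k).mulVecLin

/-- The vector `B₁ ^ i B₂ ^ j I(w a)` of `V 0`, where `w a` is the `a`-th basis vector of `W`. -/
def monomialVec (X : Rep r n) (a : Fin r) (i j : ℕ) : Fin (n 0) → ℂ :=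
  (X.B₁ 0 ^ i * X.B₂ 0 ^ j * X.I) *ᵥ Pi.single a 1

end Rep

/-- The chamber of stability parameters: `θ i > 0` for `i > 0` and
`θ 0 + ∑ i > 0, n i * θ i < 0`. -/
def Chamber (n : Fin (m + 1) → ℕ) : Set (Fin (m + 1) → ℝ) :=
  {θ | (∀ i : Fin m, 0 < θ i.succ) ∧ θ 0 + ∑ i : Fin m, (n i.succ : ℝ) * θ i.succ < 0}

/-- The stable representations satisfying the relations. -/
def StableRep (r : ℕ) (n : Fin (m + 1) → ℕ) (θ : Fin (m + 1) → ℝ) :=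
  {X : Rep r n // X.Relations ∧ X.IsStable θ}

variable {θ : Fin (m + 1) → ℝ}

instance : TopologicalSpace (StableRep r n θ) := instTopologicalSpaceSubtype

instance : MulAction (Torus r) (StableRep r n θ) where
  smul t X := ⟨t • X.1, X.2.1.torus_smul t, X.2.2.torus_smul t⟩
  one_smul X := Subtype.ext (one_smul _ X.1)
  mul_smul s t X := Subtype.ext (mul_smul s t X.1)

/-- Two stable representations are isomorphic if they lie in one orbit of the gauge group. -/
instance gaugeSetoid (r : ℕ) (n : Fin (m + 1) → ℕ) (θ : Fin (m + 1) → ℝ) :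
    Setoid (StableRep r n θ) :=
  (MulAction.orbitRel (Gauge n) (Rep r n)).comap Subtype.val

/-- The moduli space `N(r, n 0, …, n m)` of stable framed representations, with the quotient
topology. -/
def Moduli (r : ℕ) (n : Fin (m + 1) → ℕ) (θ : Fin (m + 1) → ℝ) :=
  Quotient (gaugeSetoid r n θ)

instance : TopologicalSpace (Moduli r n θ) := instTopologicalSpaceQuotient

/-- The isomorphism class of a stable representation. -/
def Moduli.mk (X : StableRep r n θ) : Moduli r n θ := Quotient.mk _ X

instance : MulAction (Torus r) (Moduli r n θ) where
  smul t := Quotient.map (fun X => t • X) fun X Y h => by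
    obtain ⟨g, hg⟩ := h
    refine ⟨g, ?_⟩
    change g • (t • Y.1) = t • X.1
    rw [← smul_comm, ← hg]
  one_smul p := by
    induction p using Quotient.inductionOn with
    | h X => exact congrArg (Quotient.mk _) (one_smul _ X)
  mul_smul s t p := by
    induction p using Quotient.inductionOn with
    | h X => exact congrArg (Quotient.mk _) (mul_smul s t X)

/-- The fixed locus of the torus in the moduli space. -/
def fixedLocus (r : ℕ) (n : Fin (m + 1) → ℕ) (θ : Fin (m + 1) → ℝ) : Set (Moduli r n θ) :=
  MulAction.fixedPoints (Torus r) (Moduli r n θ)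

/-- The fixed locus of the compact torus in the moduli space. -/
def compactFixedLocus (r : ℕ) (n : Fin (m + 1) → ℕ) (θ : Fin (m + 1) → ℝ) :
    Set (Moduli r n θ) :=
  MulAction.fixedPoints (compactTorus r) (Moduli r n θ)

/-- `r`-coloured partitions, as `r`-tuples of Young diagrams ordered by componentwise inclusion. -/
abbrev ColouredPartition (r : ℕ) := Fin r → YoungDiagram

/-- The number of boxes of a coloured partition. -/
def ColouredPartition.size (μ : ColouredPartition r) : ℕ := ∑ a, (μ a).card

/-- Tuples of coloured partitions `μ 1 ⊆ ⋯ ⊆ μ m ⊆ μ 0` with `|μ 0| = n 0` and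
`|μ i| = n 0 - n i` for `i > 0`. -/
structure NestedPartition (r : ℕ) (n : Fin (m + 1) → ℕ) where
  μ : Fin (m + 1) → ColouredPartition r
  mono : ∀ i j : Fin m, i ≤ j → μ i.succ ≤ μ j.succ
  le_zero : ∀ i : Fin m, μ i.succ ≤ μ 0
  size_zero : (μ 0).size = n 0
  size_succ : ∀ i : Fin m, (μ i.succ).size + n i.succ = n 0

end NestedInstanton

end

/-! In this chamber θ-stability is equivalent to two linear conditions: every composite `V k → V 0`
is injective (`InjectsInV₀`), and the image of `I` generates `V 0` under `B₁`, `B₂` (`IsGenerated`).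
A stable representation is thus an ADHM-type datum on `V 0` with a flag of invariant subspaces
`imageInV₀ k`, and isomorphisms only have to be found on `V 0`.

If the class of `X` is fixed by the compact torus, each `t` is compensated by a gauge transformation
`g`. Generation makes `V 0` a sum of spaces on which the compensators act by characters t₁^p t₂^q
R_a⁻¹ with p, q ≥ 0. The factor t₁t₂ in the action on `J` then forces `J = 0`, so `B₁ 0` and `B₂ 0`
commute and the monomial vectors span `V 0`. They are simultaneous eigenvectors with pairwise
distinct characters, and the subspaces `imageInV₀ k` are preserved, so a combination of them lies in
such a subspace only if each term does. This is `IsMonomial`.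

A monomial representation is determined up to isomorphism by which monomial vectors lie in which
`imageInV₀ k` (`IsMonomial.exists_gauge_smul_eq`). The full torus only rescales these vectors, so
monomial classes are fixed by all of it and the two fixed loci agree. The boxes outside `imageInV₀
k` form Young diagrams with the right sizes, and `NestedPartition.rep` realises every nested tuple.

Discreteness is semicontinuity: linear independence is open, so near a fixed point the diagrams can
only grow, while the dimensions fix their sizes. -/

noncomputable section

namespace NestedInstanton

variable {r m : ℕ} {n : Fin (m + 1) → ℕ} {θ : Fin (m + 1) → ℝ}

/-! ### Stability in the chamber as injectivity and generation. -/

namespace Rep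

/-- The maps `V k → V 0` are injective. -/
def InjectsInV₀ (X : Rep r n) : Prop := ∀ k, Function.Injective (X.toV₀ k).mulVec

/-- The image of the framing generates `V 0` under `B₁` and `B₂`. -/
def IsGenerated (X : Rep r n) : Prop :=
  ∀ S : Submodule ℂ (Fin (n 0) → ℂ), (∀ v ∈ S, X.B₁ 0 *ᵥ v ∈ S) → (∀ v ∈ S, X.B₂ 0 *ᵥ v ∈ S) →
    (∀ w, X.I *ᵥ w ∈ S) → S = ⊤

@[simp]
theorem toV₀_zero (X : Rep r n) : X.toV₀ 0 = 1 := rfl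

theorem toV₀_succ (X : Rep r n) (i : Fin m) :
    X.toV₀ i.succ = X.toV₀ i.castSucc * X.F i := rfl

theorem Relations.toV₀_mul_B₁ {X : Rep r n} (hX : X.Relations) (k : Fin (m + 1)) :
    X.toV₀ k * X.B₁ k = X.B₁ 0 * X.toV₀ k := by
  induction k using Fin.induction with
  | zero => simp
  | succ i ih =>
    rw [toV₀_succ, Matrix.mul_assoc, ← sub_eq_zero.1 (hX.b₁F i), ← Matrix.mul_assoc, ih,
      Matrix.mul_assoc]

theorem Relations.toV₀_mul_B₂ {X : Rep r n} (hX : X.Relations) (k : Fin (m + 1)) :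
    X.toV₀ k * X.B₂ k = X.B₂ 0 * X.toV₀ k := by
  induction k using Fin.induction with
  | zero => simp
  | succ i ih =>
    rw [toV₀_succ, Matrix.mul_assoc, ← sub_eq_zero.1 (hX.b₂F i), ← Matrix.mul_assoc, ih,
      Matrix.mul_assoc]

/-- The invariant family of subspaces `V k ∩ S` obtained from an invariant subspace of `V 0`. -/
theorem Relations.isInvariant_comap {X : Rep r n} (hX : X.Relations)
    {S : Submodule ℂ (Fin (n 0) → ℂ)} (h₁ : ∀ v ∈ S, X.B₁ 0 *ᵥ v ∈ S)
    (h₂ : ∀ v ∈ S, X.B₂ 0 *ᵥ v ∈ S) :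
    X.IsInvariant fun k => S.comap (X.toV₀ k).mulVecLin where
  b₁ i v hv := by
    simp only [Submodule.mem_comap, Matrix.mulVecLin_apply] at hv ⊢
    rw [Matrix.mulVec_mulVec, hX.toV₀_mul_B₁, ← Matrix.mulVec_mulVec]
    exact h₁ _ hv
  b₂ i v hv := by
    simp only [Submodule.mem_comap, Matrix.mulVecLin_apply] at hv ⊢
    rw [Matrix.mulVec_mulVec, hX.toV₀_mul_B₂, ← Matrix.mulVec_mulVec]
    exact h₂ _ hv
  f i v hv := by
    simpa [toV₀_succ, Matrix.mulVec_mulVec] using hv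

/-- The kernels of the maps to `V 0` form an invariant family with zero component at node 0. Its
slope is a sum of nonnegative terms, so stability forces the family to vanish. -/
theorem IsStable.injectsInV₀ {X : Rep r n} (hθ : θ ∈ Chamber n) (hX : X.Relations)
    (hs : X.IsStable θ) : X.InjectsInV₀ := by
  have hinv := hX.isInvariant_comap (S := ⊥) (by simp) (by simp)
  set S : ∀ k, Submodule ℂ (Fin (n k) → ℂ) := fun k => (⊥ : Submodule ℂ (Fin (n 0) → ℂ)).comap
    (X.toV₀ k).mulVecLin with hS
  have hS0 : S 0 = ⊥ := by
    ext v
    simp [hS]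
  have h0 : S = fun _ => ⊥ := by
    by_contra hne
    have h := hs.of_le_ker S hinv (by rw [hS0]; simp) hne
    rw [slope, Fin.sum_univ_succ, hS0] at h
    have : 0 ≤ ∑ i : Fin m, θ i.succ * (Module.finrank ℂ (S i.succ) : ℝ) :=
      Finset.sum_nonneg fun i _ => mul_nonneg (hθ.1 i).le (Nat.cast_nonneg _)
    simp only [finrank_bot, Nat.cast_zero, mul_zero, zero_add] at h
    exact absurd h this.not_gt
  intro k
  have hk := congrFun h0 k
  exact LinearMap.ker_eq_bot.1 hk

/-- A proper invariant S ⊇ im I pulls back to an invariant family whose dimension at node 0 is at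
most `n 0 - 1`. As θ₀ is negative and outweighs all the positive contributions n_i θ_i together,
this family has slope larger than θ(V), a contradiction. -/
theorem IsStable.isGenerated {X : Rep r n} (hθ : θ ∈ Chamber n) (hX : X.Relations)
    (hs : X.IsStable θ) : X.IsGenerated := by
  intro S h₁ h₂ hI
  by_contra hne
  have hinv := hX.isInvariant_comap h₁ h₂
  set T : ∀ k, Submodule ℂ (Fin (n k) → ℂ) := fun k => S.comap (X.toV₀ k).mulVecLin with hT
  have hT0 : T 0 = S := by
    ext v
    simp [hT]
  have h := hs.of_range_le T hinv (by rwa [hT0]) fun hT' => hne (hT0 ▸ congrFun hT' 0)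
  rw [slope, Fin.sum_univ_succ, Fin.sum_univ_succ (fun i => θ i * (n i : ℝ)), hT0] at h
  have hlt : Module.finrank ℂ S + 1 ≤ n 0 := by
    simpa using Submodule.finrank_lt hne
  have hlt' : (Module.finrank ℂ S : ℝ) + 1 ≤ n 0 := by exact_mod_cast hlt
  have hpos : 0 ≤ ∑ i : Fin m, θ i.succ * (Module.finrank ℂ (T i.succ) : ℝ) :=
    Finset.sum_nonneg fun i _ => mul_nonneg (hθ.1 i).le (Nat.cast_nonneg _)
  have hpos' : 0 ≤ ∑ i : Fin m, θ i.succ * (n i.succ : ℝ) :=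
    Finset.sum_nonneg fun i _ => mul_nonneg (hθ.1 i).le (Nat.cast_nonneg _)
  have h2 : θ 0 + ∑ i : Fin m, θ i.succ * (n i.succ : ℝ) < 0 := by
    simpa only [mul_comm] using hθ.2
  nlinarith

/-- By injectivity a nonzero invariant family is nonzero at node 0, and one copy of θ₀ already beats
everything the other nodes can add. If the family contains im I, it is all of `V 0` by generation,
and any deficit sits at nodes with positive θ. -/
theorem isStable_of_injectsInV₀_of_isGenerated {X : Rep r n} (hθ : θ ∈ Chamber n)
    (hinj : X.InjectsInV₀) (hgen : X.IsGenerated) : X.IsStable θ where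
  of_le_ker S hS _ hne := by
    have hmaps : ∀ k, ∀ v ∈ S k, X.toV₀ k *ᵥ v ∈ S 0 := by
      intro k
      induction k using Fin.induction with
      | zero => simp
      | succ i ih =>
        intro v hv
        rw [toV₀_succ, ← Matrix.mulVec_mulVec]
        exact ih _ (hS.f i v hv)
    have h0 : S 0 ≠ ⊥ := by
      intro h0
      refine hne (funext fun k => (Submodule.eq_bot_iff _).2 fun v hv => hinj k ?_)
      have := hmaps k v hv
      rw [h0, Submodule.mem_bot] at this
      simp [this]
    have h1 : 1 ≤ Module.finrank ℂ (S 0) := by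
      rw [Nat.one_le_iff_ne_zero, Ne, Submodule.finrank_eq_zero]
      exact h0
    have h1' : (1 : ℝ) ≤ Module.finrank ℂ (S 0) := by exact_mod_cast h1
    have hpos' : 0 ≤ ∑ i : Fin m, θ i.succ * (n i.succ : ℝ) :=
      Finset.sum_nonneg fun i _ => mul_nonneg (hθ.1 i).le (Nat.cast_nonneg _)
    have h2 : θ 0 + ∑ i : Fin m, θ i.succ * (n i.succ : ℝ) < 0 := by
      simpa only [mul_comm] using hθ.2
    have h3 : ∑ i : Fin m, θ i.succ * (Module.finrank ℂ (S i.succ) : ℝ) ≤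
        ∑ i : Fin m, θ i.succ * (n i.succ : ℝ) := by
      refine Finset.sum_le_sum fun i _ => mul_le_mul_of_nonneg_left ?_ (hθ.1 i).le
      have := Submodule.finrank_le (S i.succ)
      rw [Module.finrank_fin_fun] at this
      exact_mod_cast this
    rw [slope, Fin.sum_univ_succ]
    nlinarith
  of_range_le S hS hI hne := by
    have h0 : S 0 = ⊤ := hgen _ (hS.b₁ 0) (hS.b₂ 0) hI
    rw [slope]
    have hle : ∀ k, Module.finrank ℂ (S k) ≤ n k := fun k => by
      simpa using Submodule.finrank_le (S k)
    obtain ⟨k, hk⟩ := Function.ne_iff.1 hne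
    refine Finset.sum_lt_sum (fun i _ => ?_) ⟨k, Finset.mem_univ _, ?_⟩
    · cases i using Fin.cases with
      | zero => rw [h0, finrank_top, Module.finrank_fin_fun]
      | succ i =>
        exact mul_le_mul_of_nonneg_left (by exact_mod_cast hle _) (hθ.1 i).le
    · cases k using Fin.cases with
      | zero => exact absurd h0 hk
      | succ i =>
        refine mul_lt_mul_of_pos_left ?_ (hθ.1 i)
        have := Submodule.finrank_lt hk
        rw [Module.finrank_fin_fun] at this
        exact_mod_cast this

/-! ### Monomial vectors of `V 0`. -/

/-- The monomial vectors, indexed by coloured boxes. -/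
def boxVec (X : Rep r n) (b : Fin r × ℕ × ℕ) : Fin (n 0) → ℂ := X.monomialVec b.1 b.2.1 b.2.2

theorem boxVec_zero (X : Rep r n) (a : Fin r) : X.boxVec (a, 0, 0) = X.I *ᵥ Pi.single a 1 := by
  simp [boxVec, monomialVec]

theorem B₁_mulVec_boxVec (X : Rep r n) (a : Fin r) (p q : ℕ) :
    X.B₁ 0 *ᵥ X.boxVec (a, p, q) = X.boxVec (a, p + 1, q) := by
  simp only [boxVec, monomialVec, Matrix.mulVec_mulVec, pow_succ', Matrix.mul_assoc]

theorem Relations.commute {X : Rep r n} (hX : X.Relations) (hJ : X.J = 0) :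
    Commute (X.B₁ 0) (X.B₂ 0) := by
  have := hX.adhm
  rw [hJ, Matrix.mul_zero, add_zero, sub_eq_zero] at this
  exact this

/-- In a monomial the powers of `B₁` stand to the left, so `B₂` has to be moved past them; `B₁`
needs no such hypothesis. -/
theorem B₂_mulVec_boxVec {X : Rep r n} (h : Commute (X.B₁ 0) (X.B₂ 0)) (a : Fin r) (p q : ℕ) :
    X.B₂ 0 *ᵥ X.boxVec (a, p, q) = X.boxVec (a, p, q + 1) := by
  have := (h.pow_left p).eq
  simp only [boxVec, monomialVec, Matrix.mulVec_mulVec, pow_succ']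
  rw [← Matrix.mul_assoc, ← Matrix.mul_assoc, ← this]
  simp only [Matrix.mul_assoc]

theorem IsGenerated.span_boxVec {X : Rep r n} (hX : X.IsGenerated)
    (h : Commute (X.B₁ 0) (X.B₂ 0)) : Submodule.span ℂ (Set.range X.boxVec) = ⊤ := by
  refine hX _ (fun v hv => ?_) (fun v hv => ?_) fun w => ?_
  · induction hv using Submodule.span_induction with
    | mem x hx =>
      obtain ⟨⟨a, p, q⟩, rfl⟩ := hx
      rw [B₁_mulVec_boxVec]
      exact Submodule.subset_span ⟨_, rfl⟩
    | zero => simp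
    | add x y _ _ hx hy => rw [Matrix.mulVec_add]; exact add_mem hx hy
    | smul c x _ hx => rw [Matrix.mulVec_smul]; exact Submodule.smul_mem _ _ hx
  · induction hv using Submodule.span_induction with
    | mem x hx =>
      obtain ⟨⟨a, p, q⟩, rfl⟩ := hx
      rw [B₂_mulVec_boxVec h]
      exact Submodule.subset_span ⟨_, rfl⟩
    | zero => simp
    | add x y _ _ hx hy => rw [Matrix.mulVec_add]; exact add_mem hx hy
    | smul c x _ hx => rw [Matrix.mulVec_smul]; exact Submodule.smul_mem _ _ hx
  · rw [pi_eq_sum_univ' w, Matrix.mulVec_sum]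
    refine sum_mem fun a _ => ?_
    rw [Matrix.mulVec_smul]
    refine Submodule.smul_mem _ _ (Submodule.subset_span ⟨(a, 0, 0), ?_⟩)
    rw [boxVec_zero]

theorem Relations.B₁_mulVec_mem_imageInV₀ {X : Rep r n} (hX : X.Relations) {k : Fin (m + 1)}
    {v : Fin (n 0) → ℂ} (hv : v ∈ X.imageInV₀ k) : X.B₁ 0 *ᵥ v ∈ X.imageInV₀ k := by
  unfold imageInV₀ at hv ⊢
  split_ifs with h
  · simp_all
  · rw [if_neg h] at hv
    obtain ⟨u, rfl⟩ := hv
    exact ⟨X.B₁ k *ᵥ u, by simp [Matrix.mulVec_mulVec, hX.toV₀_mul_B₁]⟩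

theorem Relations.B₂_mulVec_mem_imageInV₀ {X : Rep r n} (hX : X.Relations) {k : Fin (m + 1)}
    {v : Fin (n 0) → ℂ} (hv : v ∈ X.imageInV₀ k) : X.B₂ 0 *ᵥ v ∈ X.imageInV₀ k := by
  unfold imageInV₀ at hv ⊢
  split_ifs with h
  · simp_all
  · rw [if_neg h] at hv
    obtain ⟨u, rfl⟩ := hv
    exact ⟨X.B₂ k *ᵥ u, by simp [Matrix.mulVec_mulVec, hX.toV₀_mul_B₂]⟩

/-! ### Behaviour under the gauge group and the torus. -/

theorem imageInV₀_zero (X : Rep r n) : X.imageInV₀ 0 = ⊥ := if_pos rfl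

theorem imageInV₀_succ (X : Rep r n) (i : Fin m) :
    X.imageInV₀ i.succ = LinearMap.range (X.toV₀ i.succ).mulVecLin := if_neg (Fin.succ_ne_zero i)

theorem toV₀_gauge_smul (g : Gauge n) (X : Rep r n) (k : Fin (m + 1)) :
    (g • X).toV₀ k = (g 0).val * X.toV₀ k * (g k)⁻¹.val := by
  induction k using Fin.induction with
  | zero => simp
  | succ i ih =>
    rw [toV₀_succ, ih, toV₀_succ, gauge_smul_def, gaugeAct_F]
    have : (g i.castSucc)⁻¹.val * (g i.castSucc).val = 1 := Units.inv_mul _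
    simp only [Matrix.mul_assoc]
    rw [← Matrix.mul_assoc (g i.castSucc)⁻¹.val, this, Matrix.one_mul]

/-- The torus does not touch the arrows `F`. -/
theorem imageInV₀_torus_smul (t : Torus r) (X : Rep r n) (k : Fin (m + 1)) :
    (t • X).imageInV₀ k = X.imageInV₀ k := rfl

theorem imageInV₀_gauge_smul (g : Gauge n) (X : Rep r n) (k : Fin (m + 1)) :
    (g • X).imageInV₀ k = (X.imageInV₀ k).map (g 0).val.mulVecLin := by
  unfold imageInV₀
  split_ifs with h
  · simp
  · rw [toV₀_gauge_smul]
    ext v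
    simp only [LinearMap.mem_range, Submodule.mem_map, Matrix.mulVecLin_apply,
      exists_exists_eq_and]
    constructor
    · rintro ⟨u, rfl⟩
      exact ⟨(g k)⁻¹.val *ᵥ u, by simp only [Matrix.mulVec_mulVec, Matrix.mul_assoc]⟩
    · rintro ⟨u, rfl⟩
      refine ⟨(g k).val *ᵥ u, ?_⟩
      have : (g k)⁻¹.val * (g k).val = 1 := Units.inv_mul _
      simp only [Matrix.mulVec_mulVec, Matrix.mul_assoc, this, Matrix.mul_one]

theorem boxVec_gauge_smul (g : Gauge n) (X : Rep r n) (b : Fin r × ℕ × ℕ) :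
    (g • X).boxVec b = (g 0).val *ᵥ X.boxVec b := by
  simp only [boxVec, monomialVec, gauge_smul_def, gaugeAct, Matrix.mulVec_mulVec]
  congr 1
  have h1 : ∀ (A : Matrix (Fin (n 0)) (Fin (n 0)) ℂ) (p : ℕ),
      ((g 0).val * A * (g 0)⁻¹.val) ^ p = (g 0).val * A ^ p * (g 0)⁻¹.val :=
    fun A p => Units.conj_pow (g 0) A p
  have h2 : (g 0)⁻¹.val * (g 0).val = 1 := Units.inv_mul _
  rw [h1, h1]
  simp only [Matrix.mul_assoc]
  rw [← Matrix.mul_assoc (g 0)⁻¹.val (g 0).val, h2, ← Matrix.mul_assoc (g 0)⁻¹.val (g 0).val, h2]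
  simp

theorem mulVec_gauge_injective (g : Gauge n) : Function.Injective (g 0).val.mulVec :=
  Matrix.mulVec_injective_of_isUnit (g 0).isUnit

theorem boxVec_mem_imageInV₀_gauge_smul (g : Gauge n) (X : Rep r n) (b : Fin r × ℕ × ℕ)
    (k : Fin (m + 1)) :
    (g • X).boxVec b ∈ (g • X).imageInV₀ k ↔ X.boxVec b ∈ X.imageInV₀ k := by
  rw [boxVec_gauge_smul, imageInV₀_gauge_smul]
  exact (mulVec_gauge_injective g).mem_set_image (s := (X.imageInV₀ k : Set _))

/-- The character of the torus attached to a coloured box. -/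
def weight (t : Torus r) (b : Fin r × ℕ × ℕ) : ℂ :=
  (t.1.1 : ℂ) ^ b.2.1 * (t.1.2 : ℂ) ^ b.2.2 * (t.2 b.1 : ℂ)⁻¹

theorem weight_ne_zero (t : Torus r) (b : Fin r × ℕ × ℕ) : weight t b ≠ 0 := by
  simp [weight]

theorem boxVec_torus_smul (t : Torus r) (X : Rep r n) (b : Fin r × ℕ × ℕ) :
    (t • X).boxVec b = weight t b • X.boxVec b := by
  simp only [boxVec, monomialVec, torus_smul_def, torusAct, weight, smul_pow, Matrix.smul_mul,
    Matrix.mul_smul, Matrix.smul_mulVec, smul_smul, ← Matrix.mul_assoc]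
  rw [← Matrix.mulVec_mulVec, mul_assoc, mul_comm ((t.1.2 : ℂ) ^ _)]
  have : (Matrix.diagonal fun a => (t.2 a : ℂ)⁻¹) *ᵥ Pi.single b.1 (1 : ℂ) =
      (t.2 b.1 : ℂ)⁻¹ • Pi.single b.1 1 := by
    ext a
    rw [Matrix.mulVec_diagonal]
    by_cases h : a = b.1
    · subst h; simp
    · simp [h]
  rw [this, Matrix.mulVec_smul, smul_smul]
  congr 1
  ring

/-- A representation is monomial if `J = 0` and every quotient of `V 0` by `imageInV₀ k` has the
nonzero monomial vectors as linearly independent elements. -/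
structure IsMonomial (X : Rep r n) : Prop where
  J_eq_zero : X.J = 0
  smul_mem : ∀ k (c : Fin r × ℕ × ℕ →₀ ℂ), Finsupp.linearCombination ℂ X.boxVec c ∈ X.imageInV₀ k →
    ∀ b, c b • X.boxVec b ∈ X.imageInV₀ k

end Rep

/-! ### Separation of characters. -/

/-- A sum of simultaneous eigenvectors with distinct characters lies in an invariant subspace only
if every summand does. -/
theorem mem_of_sum_simultaneous_eigenvectors_mem {K V T ι : Type*} [Field K] [AddCommGroup V]
    [Module K V] (U : Submodule K V) (G : T → V →ₗ[K] V) (hU : ∀ t, ∀ u ∈ U, G t u ∈ U)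
    (χ : T → ι → K) (hχ : ∀ b b', b ≠ b' → ∃ t, χ t b ≠ χ t b') (s : Finset ι) :
    ∀ x : ι → V, (∀ t, ∀ b ∈ s, G t (x b) = χ t b • x b) → ∑ b ∈ s, x b ∈ U →
      ∀ b ∈ s, x b ∈ U := by
  classical
  induction s using Finset.strongInduction with
  | H s ih =>
    intro x hx hsum b hb
    by_cases hs : ∃ b' ∈ s, b' ≠ b
    · obtain ⟨b', hb', hne⟩ := hs
      obtain ⟨t, ht⟩ := hχ b b' hne.symm
      -- The operator `G t - χ t b'` preserves `U`, kills `x b'` and multiplies `x b` by a nonzero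
      -- scalar, so one summand disappears without losing `b`.
      have h := ih (s.erase b') (Finset.erase_ssubset hb')
        (fun i => (χ t i - χ t b') • x i)
        (fun t' i hi => by
          rw [map_smul, hx t' i (Finset.mem_of_mem_erase hi), smul_comm])
        (by
          have h1 : G t (∑ b ∈ s, x b) - χ t b' • ∑ b ∈ s, x b ∈ U :=
            sub_mem (hU t _ hsum) (U.smul_mem _ hsum)
          rw [map_sum, Finset.smul_sum, ← Finset.sum_sub_distrib,
            ← Finset.add_sum_erase _ _ hb', hx t b' hb', sub_self, zero_add] at h1
          convert h1 using 1
          refine Finset.sum_congr rfl fun i hi => ?_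
          rw [hx t i (Finset.mem_of_mem_erase hi), sub_smul])
        b (Finset.mem_erase.2 ⟨hne.symm, hb⟩)
      exact (U.smul_mem_iff (sub_ne_zero.2 ht)).1 h
    · push Not at hs
      have : s = {b} := Finset.eq_singleton_iff_unique_mem.2 ⟨hb, hs⟩
      rwa [this, Finset.sum_singleton] at hsum

/-- A root of unity of given order. -/
theorem exists_unit_norm_one_pow_injOn (N : ℕ) :
    ∃ ζ : ℂˣ, ‖(ζ : ℂ)‖ = 1 ∧ ∀ p ≤ N, ∀ q ≤ N, (ζ : ℂ) ^ p = (ζ : ℂ) ^ q → p = q := by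
  -- Order `N + 1` is what separates the exponents 0, …, N.
  have h := Complex.isPrimitiveRoot_exp (N + 1) N.succ_ne_zero
  exact ⟨Units.mk0 _ (h.ne_zero N.succ_ne_zero), h.norm'_eq_one N.succ_ne_zero,
    fun p hp q hq hpq => h.pow_inj (Nat.lt_succ_of_le hp) (Nat.lt_succ_of_le hq) hpq⟩

namespace Rep

theorem exists_weight_ne {b b' : Fin r × ℕ × ℕ} (h : b ≠ b') :
    ∃ t : compactTorus r, weight t.1 b ≠ weight t.1 b' := by
  obtain ⟨a, p, q⟩ := b
  obtain ⟨a', p', q'⟩ := b'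
  by_cases ha : a = a'
  · by_cases hp : p = p'
    · have hq : q ≠ q' := fun hq => h (by rw [ha, hp, hq])
      obtain ⟨ζ, hζ, hinj⟩ := exists_unit_norm_one_pow_injOn (max q q')
      refine ⟨⟨((1, ζ), 1), by simp [compactTorus, hζ]⟩, fun h' => hq ?_⟩
      exact hinj _ (le_max_left _ _) _ (le_max_right _ _) (by simpa [weight] using h')
    · obtain ⟨ζ, hζ, hinj⟩ := exists_unit_norm_one_pow_injOn (max p p')
      refine ⟨⟨((ζ, 1), 1), by simp [compactTorus, hζ]⟩, fun h' => hp ?_⟩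
      exact hinj _ (le_max_left _ _) _ (le_max_right _ _) (by simpa [weight] using h')
  -- For different colours a sign on the colour `a` alone is enough.
  · refine ⟨⟨(1, fun i => if i = a then -1 else 1), ?_⟩, ?_⟩
    · refine ⟨by simp, by simp, fun i => ?_⟩
      dsimp only
      split_ifs <;> simp
    · simp only [weight, Prod.fst_one, Prod.snd_one, Units.val_one, one_pow, one_mul,
        if_true, if_neg (Ne.symm ha)]
      norm_num

/-! ### Classes fixed by the compact torus are monomial. -/

/-- The isomorphism class of `X` is fixed by the compact torus. -/
def IsCompactFixed (X : Rep r n) : Prop := ∀ t ∈ compactTorus r, ∃ g : Gauge n, g • X = t • X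

section CompactFixed

variable {X : Rep r n} {t : Torus r} {g : Gauge n}

theorem mulVec_B₁_of_smul_eq (h : g • X = t • X) (v : Fin (n 0) → ℂ) :
    (g 0).val *ᵥ (X.B₁ 0 *ᵥ v) = (t.1.1 : ℂ) • X.B₁ 0 *ᵥ ((g 0).val *ᵥ v) := by
  have h1 := congrFun (congrArg Rep.B₁ h) 0
  rw [gauge_smul_def, torus_smul_def, gaugeAct_B₁, torusAct_B₁] at h1
  have h2 : (g 0).val * X.B₁ 0 = (t.1.1 : ℂ) • X.B₁ 0 * (g 0).val := by
    rw [← h1, Matrix.mul_assoc _ (g 0)⁻¹.val, Units.inv_mul, Matrix.mul_one]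
  rw [Matrix.mulVec_mulVec, h2, ← Matrix.mulVec_mulVec, Matrix.smul_mulVec]

theorem mulVec_B₂_of_smul_eq (h : g • X = t • X) (v : Fin (n 0) → ℂ) :
    (g 0).val *ᵥ (X.B₂ 0 *ᵥ v) = (t.1.2 : ℂ) • X.B₂ 0 *ᵥ ((g 0).val *ᵥ v) := by
  have h1 := congrFun (congrArg Rep.B₂ h) 0
  rw [gauge_smul_def, torus_smul_def, gaugeAct_B₂, torusAct_B₂] at h1
  have h2 : (g 0).val * X.B₂ 0 = (t.1.2 : ℂ) • X.B₂ 0 * (g 0).val := by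
    rw [← h1, Matrix.mul_assoc _ (g 0)⁻¹.val, Units.inv_mul, Matrix.mul_one]
  rw [Matrix.mulVec_mulVec, h2, ← Matrix.mulVec_mulVec, Matrix.smul_mulVec]

theorem mulVec_boxVec_of_smul_eq (h : g • X = t • X) (b : Fin r × ℕ × ℕ) :
    (g 0).val *ᵥ X.boxVec b = weight t b • X.boxVec b := by
  rw [← boxVec_gauge_smul, h, boxVec_torus_smul]

theorem J_mulVec_of_smul_eq (h : g • X = t • X) (v : Fin (n 0) → ℂ) (hR : t.2 = 1) :
    X.J *ᵥ v = ((t.1.1 : ℂ) * (t.1.2 : ℂ)) • X.J *ᵥ ((g 0).val *ᵥ v) := by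
  have h1 := congrArg Rep.J h
  rw [gauge_smul_def, torus_smul_def, gaugeAct_J, torusAct_J, hR] at h1
  have h2 : X.J = ((t.1.1 : ℂ) * (t.1.2 : ℂ)) • X.J * (g 0).val := by
    have h3 := congrArg (· * (g 0).val) h1
    simpa [Matrix.mul_assoc, Units.inv_mul] using h3
  conv_lhs => rw [h2]
  rw [← Matrix.mulVec_mulVec, Matrix.smul_mulVec]

theorem imageInV₀_invariant_of_smul_eq (h : g • X = t • X) {k : Fin (m + 1)}
    {v : Fin (n 0) → ℂ} (hv : v ∈ X.imageInV₀ k) : (g 0).val *ᵥ v ∈ X.imageInV₀ k := by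
  rw [← imageInV₀_torus_smul t, ← h, imageInV₀_gauge_smul]
  exact Submodule.mem_map_of_mem hv

end CompactFixed

/-- The vectors of `V 0` on which the gauge transformations compensating the compact torus act
through the character of the box `b`. -/
def weightSpace (X : Rep r n) (b : Fin r × ℕ × ℕ) : Submodule ℂ (Fin (n 0) → ℂ) where
  carrier := {v | ∀ t ∈ compactTorus r, ∀ g : Gauge n, g • X = t • X →
    (g 0).val *ᵥ v = weight t b • v}
  add_mem' hv hw t ht g hg := by
    rw [Matrix.mulVec_add, hv t ht g hg, hw t ht g hg, smul_add]
  zero_mem' t ht g hg := by simp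
  smul_mem' c v hv t ht g hg := by
    rw [Matrix.mulVec_smul, hv t ht g hg, smul_comm]

/-- `B₁` and `B₂` shift the weight spaces and `I` lands in those with p = q = 0. Weight spaces
replace monomial vectors here because `B₁` and `B₂` are not yet known to commute. -/
theorem IsGenerated.iSup_weightSpace {X : Rep r n} (hX : X.IsGenerated) :
    ⨆ b, X.weightSpace b = ⊤ := by
  refine hX _ (fun v hv => ?_) (fun v hv => ?_) fun w => ?_
  · induction hv using Submodule.iSup_induction' with
    | mem b x hx =>
      obtain ⟨a, p, q⟩ := b
      refine Submodule.mem_iSup_of_mem (a, p + 1, q) fun t ht g hg => ?_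
      rw [mulVec_B₁_of_smul_eq hg, hx t ht g hg, Matrix.mulVec_smul, smul_smul]
      congr 1
      simp only [weight]
      ring
    | zero => simp
    | add x y _ _ hx hy => rw [Matrix.mulVec_add]; exact add_mem hx hy
  · induction hv using Submodule.iSup_induction' with
    | mem b x hx =>
      obtain ⟨a, p, q⟩ := b
      refine Submodule.mem_iSup_of_mem (a, p, q + 1) fun t ht g hg => ?_
      rw [mulVec_B₂_of_smul_eq hg, hx t ht g hg, Matrix.mulVec_smul, smul_smul]
      congr 1
      simp only [weight]
      ring
    | zero => simp
    | add x y _ _ hx hy => rw [Matrix.mulVec_add]; exact add_mem hx hy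
  · rw [pi_eq_sum_univ' w, Matrix.mulVec_sum]
    refine sum_mem fun a _ => ?_
    rw [Matrix.mulVec_smul]
    refine Submodule.smul_mem _ _ (Submodule.mem_iSup_of_mem (a, 0, 0) fun t ht g hg => ?_)
    have := mulVec_boxVec_of_smul_eq hg (a, 0, 0)
    rwa [boxVec_zero] at this

theorem IsCompactFixed.J_eq_zero {X : Rep r n} (h : X.IsCompactFixed) (hX : X.IsGenerated) :
    X.J = 0 := by
  have hle : ⨆ b, X.weightSpace b ≤ LinearMap.ker X.J.mulVecLin := by
    refine iSup_le ?_
    rintro ⟨a, p, q⟩ v hv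
    -- For t = (ζ, 1, 1) the vector `J v` is multiplied by ζ^p from the weight of `v` and by one
    -- more ζ from the action on `J`. The exponent p + 1 is positive, so ζ can be chosen with
    -- ζ^(p+1) ≠ 1.
    obtain ⟨ζ, hζ, hinj⟩ := exists_unit_norm_one_pow_injOn (p + 1)
    have ht : (((ζ, 1), 1) : Torus r) ∈ compactTorus r := by simp [compactTorus, hζ]
    obtain ⟨g, hg⟩ := h _ ht
    have h1 := J_mulVec_of_smul_eq hg v rfl
    rw [hv _ ht g hg, Matrix.mulVec_smul, smul_smul] at h1
    rw [LinearMap.mem_ker, Matrix.mulVecLin_apply]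
    by_contra hne
    have h2 : (ζ : ℂ) ^ (p + 1) = 1 := by
      have h3 := smul_left_injective ℂ hne (h1.symm.trans (one_smul ℂ _).symm)
      simpa [weight, pow_succ'] using h3
    have := hinj (p + 1) le_rfl 0 (Nat.zero_le _) (by rw [h2, pow_zero])
    omega
  rw [hX.iSup_weightSpace, top_le_iff, LinearMap.ker_eq_top] at hle
  ext i j
  have := congrFun (LinearMap.congr_fun hle (Pi.single j 1)) i
  simpa using this

theorem IsCompactFixed.isMonomial {X : Rep r n} (h : X.IsCompactFixed) (hX : X.IsGenerated) :
    X.IsMonomial where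
  J_eq_zero := h.J_eq_zero hX
  smul_mem k c hc b := by
    by_cases hb : b ∈ c.support
    -- The compensators are chosen independently for each `t`; the eigenvector argument needs no
    -- multiplicativity in `t`.
    · choose g hg using fun t : compactTorus r => h t.1 t.2
      refine mem_of_sum_simultaneous_eigenvectors_mem (X.imageInV₀ k)
        (fun t => (g t 0).val.mulVecLin) (fun t u hu => imageInV₀_invariant_of_smul_eq (hg t) hu)
        (fun t b => weight t.1 b) (fun b b' => exists_weight_ne) c.support
        (fun b => c b • X.boxVec b) (fun t b _ => ?_) hc b hb
      rw [map_smul, Matrix.mulVecLin_apply, mulVec_boxVec_of_smul_eq (hg t), smul_comm]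
    · rw [Finsupp.notMem_support_iff.1 hb, zero_smul]
      exact zero_mem _

/-! ### Recovering a representation from its data on `V 0`. -/

/-- A matrix whose columns lie in the column space of `A` factors through `A`. -/
theorem exists_mul_eq_of_range_le {l p q : Type*} [Fintype p] [Fintype q] [DecidableEq q]
    (A : Matrix l p ℂ) (B : Matrix l q ℂ)
    (h : LinearMap.range B.mulVecLin ≤ LinearMap.range A.mulVecLin) :
    ∃ M : Matrix p q ℂ, A * M = B := by
  have h1 : ∀ j, ∃ v, A *ᵥ v = B.col j := fun j =>
    h ⟨Pi.single j 1, by simp⟩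
  choose v hv using h1
  refine ⟨Matrix.of fun i j => v j i, ?_⟩
  ext i j
  exact congrFun (hv j) i

theorem eq_of_mul_eq_mul_of_mulVec_injective {l p q : Type*} [Fintype p]
    {A : Matrix l p ℂ} (hA : Function.Injective A.mulVec) {M N : Matrix p q ℂ}
    (h : A * M = A * N) : M = N := by
  ext i j
  have : M.col j = N.col j := hA (by
    ext i
    exact congrFun (congrFun h i) j)
  exact congrFun this i

/-- An isomorphism of the spaces `V 0` compatible with all the data extends to an isomorphism of
representations. -/
theorem exists_gauge_smul_eq {X Y : Rep r n} (hX : X.Relations) (hY : Y.Relations)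
    (iX : X.InjectsInV₀) (iY : Y.InjectsInV₀) (A : Matrix.GeneralLinearGroup (Fin (n 0)) ℂ)
    (h₁ : A.val * X.B₁ 0 = Y.B₁ 0 * A.val) (h₂ : A.val * X.B₂ 0 = Y.B₂ 0 * A.val)
    (hI : A.val * X.I = Y.I) (hJ : Y.J * A.val = X.J)
    (hU : ∀ k, (X.imageInV₀ k).map A.val.mulVecLin = Y.imageInV₀ k) :
    ∃ g : Gauge n, g • X = Y := by
  have hA : A⁻¹.val * A.val = 1 := Units.inv_mul _
  have hA' : A.val * A⁻¹.val = 1 := Units.mul_inv _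
  have hk : ∀ k, ∃ g : Matrix.GeneralLinearGroup (Fin (n k)) ℂ,
      Y.toV₀ k * g.val = A.val * X.toV₀ k := by
    intro k
    cases k using Fin.cases with
    | zero => exact ⟨A, by simp⟩
    | succ i =>
      have hUi := hU i.succ
      rw [imageInV₀_succ, imageInV₀_succ] at hUi
      -- `A` identifies the two images of `V k` in `V 0`. Lifting `A` and `A⁻¹` through the
      -- injections gives mutually inverse matrices.
      obtain ⟨M, hM⟩ := exists_mul_eq_of_range_le (Y.toV₀ i.succ) (A.val * X.toV₀ i.succ) (by
        rw [← hUi, Matrix.mulVecLin_mul, LinearMap.range_comp])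
      obtain ⟨N, hN⟩ := exists_mul_eq_of_range_le (X.toV₀ i.succ) (A⁻¹.val * Y.toV₀ i.succ) (by
        rw [Matrix.mulVecLin_mul, LinearMap.range_comp, ← hUi, ← Submodule.map_comp,
          ← Matrix.mulVecLin_mul, hA, Matrix.mulVecLin_one, Submodule.map_id])
      refine ⟨⟨M, N, eq_of_mul_eq_mul_of_mulVec_injective (iY i.succ) ?_,
        eq_of_mul_eq_mul_of_mulVec_injective (iX i.succ) ?_⟩, hM⟩
      · rw [← Matrix.mul_assoc, hM, Matrix.mul_assoc, hN, ← Matrix.mul_assoc, hA', Matrix.one_mul,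
          Matrix.mul_one]
      · rw [← Matrix.mul_assoc, hN, Matrix.mul_assoc, hM, ← Matrix.mul_assoc, hA, Matrix.one_mul,
          Matrix.mul_one]
  choose g hg using hk
  have hg0 : (g 0).val = A.val := by simpa using hg 0
  have hconj : ∀ {i j : Fin (m + 1)} (M : Matrix (Fin (n i)) (Fin (n j)) ℂ)
      (N : Matrix (Fin (n i)) (Fin (n j)) ℂ),
      (g i).val * M = N * (g j).val → (g i).val * M * (g j)⁻¹.val = N := by
    intro i j M N h
    have : (g j).val * (g j)⁻¹.val = 1 := Units.mul_inv _
    rw [h, Matrix.mul_assoc, this, Matrix.mul_one]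
  -- The identities for `B₁`, `B₂` and `F` are checked after composing with an injective `Y.toV₀`,
  -- where they become identities on `V 0`.
  refine ⟨g, Rep.ext ?_ ?_ ?_ ?_ ?_⟩
  · funext k
    refine hconj _ _ (eq_of_mul_eq_mul_of_mulVec_injective (iY k) ?_)
    rw [← Matrix.mul_assoc, hg, Matrix.mul_assoc, hX.toV₀_mul_B₁, ← Matrix.mul_assoc, h₁,
      ← Matrix.mul_assoc, hY.toV₀_mul_B₁, Matrix.mul_assoc, Matrix.mul_assoc, hg]
  · funext k
    refine hconj _ _ (eq_of_mul_eq_mul_of_mulVec_injective (iY k) ?_)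
    rw [← Matrix.mul_assoc, hg, Matrix.mul_assoc, hX.toV₀_mul_B₂, ← Matrix.mul_assoc, h₂,
      ← Matrix.mul_assoc, hY.toV₀_mul_B₂, Matrix.mul_assoc, Matrix.mul_assoc, hg]
  · rw [gauge_smul_def, gaugeAct_I, hg0, hI]
  · have : (g 0).val * (g 0)⁻¹.val = 1 := Units.mul_inv _
    rw [gauge_smul_def, gaugeAct_J, ← hJ, ← hg0, Matrix.mul_assoc, this, Matrix.mul_one]
  · funext i
    refine hconj _ _ (eq_of_mul_eq_mul_of_mulVec_injective (iY i.castSucc) ?_)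
    rw [← Matrix.mul_assoc, hg, Matrix.mul_assoc, ← toV₀_succ, ← Matrix.mul_assoc, ← toV₀_succ,
      hg]

/-- Membership of a combination is thereby read off from the diagrams alone. For `k = 0`, where the
subspace is zero, this determines all linear relations among the monomial vectors. -/
theorem IsMonomial.linearCombination_mem_iff {X : Rep r n} (hX : X.IsMonomial) (k : Fin (m + 1))
    (c : Fin r × ℕ × ℕ →₀ ℂ) : Finsupp.linearCombination ℂ X.boxVec c ∈ X.imageInV₀ k ↔
      ∀ b, c b ≠ 0 → X.boxVec b ∈ X.imageInV₀ k := by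
  refine ⟨fun h b hb => (Submodule.smul_mem_iff _ hb).1 (hX.smul_mem k c h b), fun h => ?_⟩
  exact sum_mem fun b hb => Submodule.smul_mem _ _ (h b (Finsupp.mem_support_iff.1 hb))

/-- Monomial representations with the same diagrams are isomorphic. -/
theorem IsMonomial.exists_gauge_smul_eq {X Y : Rep r n} (mX : X.IsMonomial) (mY : Y.IsMonomial)
    (hX : X.Relations) (hY : Y.Relations) (iX : X.InjectsInV₀) (iY : Y.InjectsInV₀)
    (gX : X.IsGenerated) (gY : Y.IsGenerated)
    (h : ∀ k b, X.boxVec b ∈ X.imageInV₀ k ↔ Y.boxVec b ∈ Y.imageInV₀ k) :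
    ∃ g : Gauge n, g • X = Y := by
  have sX := gX.span_boxVec (hX.commute mX.J_eq_zero)
  have sY := gY.span_boxVec (hY.commute mY.J_eq_zero)
  set LX := Finsupp.linearCombination ℂ X.boxVec with hLX
  set LY := Finsupp.linearCombination ℂ Y.boxVec with hLY
  have rX : Function.Surjective LX := LinearMap.range_eq_top.1 (by
    rw [Finsupp.range_linearCombination, sX])
  have rY : Function.Surjective LY := LinearMap.range_eq_top.1 (by
    rw [Finsupp.range_linearCombination, sY])
  have hmem : ∀ k c, LX c ∈ X.imageInV₀ k ↔ LY c ∈ Y.imageInV₀ k := by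
    intro k c
    rw [mX.linearCombination_mem_iff, mY.linearCombination_mem_iff]
    simp only [h]
  have hker : LinearMap.ker LX = LinearMap.ker LY := by
    ext c
    have := hmem 0 c
    rwa [imageInV₀_zero, imageInV₀_zero] at this
  -- Both copies of `V 0` are the quotient of the free space on coloured boxes by the same kernel.
  let e : (Fin (n 0) → ℂ) ≃ₗ[ℂ] (Fin (n 0) → ℂ) :=
    (LX.quotKerEquivOfSurjective rX).symm ≪≫ₗ Submodule.quotEquivOfEq _ _ hker ≪≫ₗ
      LY.quotKerEquivOfSurjective rY
  have he : ∀ c, e (LX c) = LY c := by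
    intro c
    have : (LX.quotKerEquivOfSurjective rX).symm (LX c) = Submodule.Quotient.mk c := by
      rw [LinearEquiv.symm_apply_eq]
      rfl
    simp only [e, LinearEquiv.trans_apply, this]
    rfl
  have heb : ∀ b, e (X.boxVec b) = Y.boxVec b := fun b => by
    simpa [hLX, hLY] using he (Finsupp.single b 1)
  obtain ⟨A, hA⟩ : ∃ A : Matrix.GeneralLinearGroup (Fin (n 0)) ℂ, ∀ v, A.val *ᵥ v = e v := by
    refine ⟨⟨LinearMap.toMatrix' e.toLinearMap, LinearMap.toMatrix' e.symm.toLinearMap, ?_, ?_⟩,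
      fun v => ?_⟩
    · rw [← LinearMap.toMatrix'_comp, LinearEquiv.comp_coe, LinearEquiv.symm_trans_self]
      exact LinearMap.toMatrix'_id
    · rw [← LinearMap.toMatrix'_comp, LinearEquiv.comp_coe, LinearEquiv.self_trans_symm]
      exact LinearMap.toMatrix'_id
    · exact LinearMap.toMatrix'_mulVec _ _
  have hext : ∀ M N : Matrix (Fin (n 0)) (Fin (n 0)) ℂ,
      (∀ b, M *ᵥ X.boxVec b = N *ᵥ X.boxVec b) → M = N := by
    intro M N hMN
    have : M.mulVecLin = N.mulVecLin := LinearMap.ext_on_range sX hMN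
    exact Matrix.toLin'.injective this
  refine Rep.exists_gauge_smul_eq hX hY iX iY A (hext _ _ ?_) (hext _ _ ?_) ?_ ?_ fun k => ?_
  · rintro ⟨a, p, q⟩
    simp only [← Matrix.mulVec_mulVec, B₁_mulVec_boxVec, hA, heb]
  · rintro ⟨a, p, q⟩
    simp only [← Matrix.mulVec_mulVec, B₂_mulVec_boxVec (hX.commute mX.J_eq_zero),
      B₂_mulVec_boxVec (hY.commute mY.J_eq_zero), hA, heb]
  · ext i a
    have := hA (X.boxVec (a, 0, 0))
    rw [heb, boxVec_zero, boxVec_zero, Matrix.mulVec_mulVec] at this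
    simpa using congrFun this i
  · rw [mX.J_eq_zero, mY.J_eq_zero, Matrix.zero_mul]
  · ext v
    rw [Submodule.mem_map]
    constructor
    · rintro ⟨u, hu, rfl⟩
      obtain ⟨c, rfl⟩ := rX u
      rw [Matrix.mulVecLin_apply, hA, he]
      exact (hmem k c).1 hu
    · intro hv
      obtain ⟨c, rfl⟩ := rY v
      exact ⟨LX c, (hmem k c).2 hv, by rw [Matrix.mulVecLin_apply, hA, he]⟩

theorem IsMonomial.torus_smul {X : Rep r n} (hX : X.IsMonomial) (t : Torus r) :
    (t • X).IsMonomial where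
  J_eq_zero := by rw [torus_smul_def, torusAct_J, hX.J_eq_zero]; simp
  smul_mem k c hc b := by
    -- The weights are absorbed into the coefficients.
    let c' : Fin r × ℕ × ℕ →₀ ℂ :=
      Finsupp.onFinset c.support (fun b => c b * weight t b) fun b hb =>
        Finsupp.mem_support_iff.2 (left_ne_zero_of_mul hb)
    have hc' : Finsupp.linearCombination ℂ X.boxVec c' =
        Finsupp.linearCombination ℂ (t • X).boxVec c := by
      rw [Finsupp.linearCombination_onFinset, Finsupp.linearCombination_apply, Finsupp.sum]
      simp only [boxVec_torus_smul, smul_smul]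
    rw [imageInV₀_torus_smul] at hc ⊢
    rw [boxVec_torus_smul, smul_smul]
    exact hX.smul_mem k c' (hc' ▸ hc) b

/-- The torus multiplies each monomial vector by a nonzero scalar and fixes the subspaces, so `t •
X` has the same diagrams as `X`. This holds for the whole algebraic torus, not only its compact
part. -/
theorem IsMonomial.exists_gauge_smul_eq_torus_smul {X : Rep r n} (mX : X.IsMonomial)
    (hX : X.Relations) (iX : X.InjectsInV₀) (gX : X.IsGenerated)
    (gtX : ∀ t : Torus r, (t • X).IsGenerated) (t : Torus r) :
    ∃ g : Gauge n, g • X = t • X := by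
  refine mX.exists_gauge_smul_eq (mX.torus_smul t) hX (hX.torus_smul t) iX iX gX (gtX t)
    fun k b => ?_
  rw [boxVec_torus_smul, imageInV₀_torus_smul, Submodule.smul_mem_iff _ (weight_ne_zero t b)]

end Rep

/-! ### The nested partition of a monomial representation. -/

namespace Rep

theorem InjectsInV₀.finrank_imageInV₀_succ {X : Rep r n} (hX : X.InjectsInV₀) (i : Fin m) :
    Module.finrank ℂ (X.imageInV₀ i.succ) = n i.succ := by
  rw [imageInV₀_succ, LinearMap.finrank_range_of_inj (hX i.succ), Module.finrank_fin_fun]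

theorem IsMonomial.linearIndependent {X : Rep r n} (hX : X.IsMonomial) (k : Fin (m + 1)) :
    LinearIndependent ℂ fun b : {b // X.boxVec b ∉ X.imageInV₀ k} =>
      (X.imageInV₀ k).mkQ (X.boxVec b) := by
  rw [linearIndependent_iff]
  intro l hl
  have h1 : Finsupp.linearCombination ℂ X.boxVec (l.mapDomain Subtype.val) ∈ X.imageInV₀ k := by
    rw [Finsupp.linearCombination_mapDomain]
    refine (Submodule.Quotient.mk_eq_zero _).1 ?_
    rw [← Submodule.mkQ_apply, Finsupp.apply_linearCombination]
    exact hl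
  rw [hX.linearCombination_mem_iff] at h1
  ext b
  by_contra hb
  refine b.2 (h1 b ?_)
  rwa [Finsupp.mapDomain_apply Subtype.val_injective]

/-- The monomial vectors outside `imageInV₀ k` give a basis of the quotient. -/
def IsMonomial.basis {X : Rep r n} (hX : X.IsMonomial) (h : X.Relations) (hg : X.IsGenerated)
    (k : Fin (m + 1)) : Module.Basis {b // X.boxVec b ∉ X.imageInV₀ k} ℂ
      ((Fin (n 0) → ℂ) ⧸ X.imageInV₀ k) :=
  Module.Basis.mk (hX.linearIndependent k) <| by
    have hs := hg.span_boxVec (h.commute hX.J_eq_zero)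
    have h1 := congrArg (Submodule.map (X.imageInV₀ k).mkQ) hs
    rw [Submodule.map_top, Submodule.range_mkQ, Submodule.map_span] at h1
    rw [← h1, Submodule.span_le]
    rintro _ ⟨_, ⟨b, rfl⟩, rfl⟩
    by_cases hb : X.boxVec b ∈ X.imageInV₀ k
    · rw [Submodule.mkQ_apply, (Submodule.Quotient.mk_eq_zero _).2 hb]
      exact zero_mem _
    · exact Submodule.subset_span ⟨⟨b, hb⟩, rfl⟩

theorem IsMonomial.finite_boxes {X : Rep r n} (hX : X.IsMonomial) (h : X.Relations)
    (hg : X.IsGenerated) (k : Fin (m + 1)) : Finite {b // X.boxVec b ∉ X.imageInV₀ k} :=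
  Module.Finite.finite_basis (hX.basis h hg k)

theorem IsMonomial.card_boxes {X : Rep r n} (hX : X.IsMonomial) (h : X.Relations)
    (hg : X.IsGenerated) (k : Fin (m + 1)) :
    Nat.card {b // X.boxVec b ∉ X.imageInV₀ k} + Module.finrank ℂ (X.imageInV₀ k) = n 0 := by
  rw [← Module.finrank_eq_nat_card_basis (hX.basis h hg k), Submodule.finrank_quotient_add_finrank,
    Module.finrank_fin_fun]

/-- Each map to `V 0` factors through the preceding one. Only successor indices are compared,
because `imageInV₀ 0` is 0 by convention and not the image of `V 0`. -/
theorem imageInV₀_succ_anti {X : Rep r n} (i j : Fin m) (hij : i ≤ j) :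
    X.imageInV₀ j.succ ≤ X.imageInV₀ i.succ := by
  have key : ∀ k : Fin (m + 1), i.succ ≤ k →
      LinearMap.range (X.toV₀ k).mulVecLin ≤ LinearMap.range (X.toV₀ i.succ).mulVecLin := by
    intro k
    induction k using Fin.induction with
    | zero => intro h; exact absurd h (Fin.succ_pos i).not_ge
    | succ l ih =>
      intro h
      rcases h.eq_or_lt with h | h
      · rw [h]
      · refine le_trans ?_ (ih (Fin.le_castSucc_iff.2 h))
        rw [toV₀_succ, Matrix.mulVecLin_mul]
        exact LinearMap.range_comp_le_range _ _
  rw [imageInV₀_succ, imageInV₀_succ]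
  exact key _ (Fin.succ_le_succ_iff.2 hij)

/-- The subspaces are invariant under `B₁` and `B₂`, so the boxes they contain form an upper set,
like the exponents of a monomial ideal. The complement is therefore a Young diagram. -/
theorem Relations.boxVec_mem_of_le {X : Rep r n} (hX : X.Relations)
    (hc : Commute (X.B₁ 0) (X.B₂ 0)) {k : Fin (m + 1)} {a : Fin r} {p q p' q' : ℕ} (hp : p ≤ p')
    (hq : q ≤ q') (h : X.boxVec (a, p, q) ∈ X.imageInV₀ k) :
    X.boxVec (a, p', q') ∈ X.imageInV₀ k := by
  induction hp with
  | refl =>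
    induction hq with
    | refl => exact h
    | step _ ih =>
      rw [← B₂_mulVec_boxVec hc]
      exact hX.B₂_mulVec_mem_imageInV₀ ih
  | step _ ih =>
    rw [← B₁_mulVec_boxVec]
    exact hX.B₁_mulVec_mem_imageInV₀ ih

/-- The nested coloured partition of a monomial representation. -/
theorem IsMonomial.exists_nestedPartition {X : Rep r n} (hX : X.IsMonomial) (h : X.Relations)
    (hg : X.IsGenerated) (hi : X.InjectsInV₀) :
    ∃ P : NestedPartition r n, ∀ k a p q,
      (p, q) ∈ P.μ k a ↔ X.boxVec (a, p, q) ∉ X.imageInV₀ k := by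
  have hfin : ∀ k a, {x : ℕ × ℕ | X.boxVec (a, x) ∉ X.imageInV₀ k}.Finite := by
    intro k a
    have hb : {b | X.boxVec b ∉ X.imageInV₀ k}.Finite :=
      Set.finite_coe_iff.1 (hX.finite_boxes h hg k)
    exact hb.preimage (f := fun x : ℕ × ℕ => (a, x)) fun x _ y _ hxy => (Prod.ext_iff.1 hxy).2
  let μ : Fin (m + 1) → ColouredPartition r := fun k a =>
    { cells := (hfin k a).toFinset
      isLowerSet := by
        rintro ⟨p', q'⟩ ⟨p, q⟩ hle hx
        simp only [Set.Finite.coe_toFinset, Set.mem_ofPred_eq] at hx ⊢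
        exact fun hmem => hx (h.boxVec_mem_of_le (h.commute hX.J_eq_zero) hle.1 hle.2 hmem) }
  have hμ : ∀ k a x, x ∈ μ k a ↔ X.boxVec (a, x) ∉ X.imageInV₀ k := by
    intro k a x
    rw [← YoungDiagram.mem_cells, Set.Finite.mem_toFinset, Set.mem_ofPred_eq]
  have hsize : ∀ k, (μ k).size = Nat.card {b // X.boxVec b ∉ X.imageInV₀ k} := by
    intro k
    have e : {b // X.boxVec b ∉ X.imageInV₀ k} ≃ Σ a, {x // x ∈ (μ k a).cells} :=
      { toFun := fun b => ⟨b.1.1, b.1.2, (hμ k _ _).2 b.2⟩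
        invFun := fun y => ⟨(y.1, y.2.1), (hμ k _ _).1 y.2.2⟩
        left_inv := fun _ => rfl
        right_inv := fun _ => rfl }
    rw [Nat.card_congr e, Nat.card_sigma]
    exact Finset.sum_congr rfl fun a _ => by
      rw [Nat.card_eq_fintype_card, Fintype.card_coe]
  refine ⟨⟨μ, fun i j hij a x hx => ?_, fun i a x hx => ?_, ?_, fun i => ?_⟩,
    fun k a p q => hμ k a (p, q)⟩
  · rw [hμ] at hx ⊢
    exact fun hmem => hx (imageInV₀_succ_anti i j hij hmem)
  · rw [hμ] at hx ⊢
    intro hmem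
    rw [imageInV₀_zero, Submodule.mem_bot] at hmem
    exact hx (hmem ▸ zero_mem _)
  · have := hX.card_boxes h hg 0
    rwa [← hsize, imageInV₀_zero, finrank_bot, add_zero] at this
  · have := hX.card_boxes h hg i.succ
    rwa [← hsize, hi.finrank_imageInV₀_succ] at this

end Rep

/-! ### Finiteness of the set of nested partitions. -/

namespace NestedPartition

theorem ext_mem {P Q : NestedPartition r n}
    (h : ∀ k a p q, (p, q) ∈ P.μ k a ↔ (p, q) ∈ Q.μ k a) : P = Q := by
  obtain ⟨μ, _⟩ := P
  obtain ⟨ν, _⟩ := Q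
  have : μ = ν := by
    funext k a
    ext ⟨p, q⟩
    exact h k a p q
  subst this
  rfl

theorem μ_le_zero (P : NestedPartition r n) (k : Fin (m + 1)) : P.μ k ≤ P.μ 0 := by
  cases k using Fin.cases with
  | zero => exact le_rfl
  | succ i => exact P.le_zero i

/-- The boxes of the coloured partitions are bounded by the total number of boxes. -/
theorem lt_of_mem (P : NestedPartition r n) {k : Fin (m + 1)} {a : Fin r} {p q : ℕ}
    (h : (p, q) ∈ P.μ k a) : p < n 0 ∧ q < n 0 := by
  have hle : (P.μ 0 a).card ≤ n 0 := by
    rw [← P.size_zero]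
    exact Finset.single_le_sum (f := fun a => (P.μ 0 a).card) (fun _ _ => Nat.zero_le _)
      (Finset.mem_univ a)
  have h0 : (p, q) ∈ P.μ 0 a := P.μ_le_zero k a h
  constructor
  · refine lt_of_lt_of_le ?_ hle
    have hsub : (Finset.range (p + 1)).image (fun i => (i, q)) ⊆ (P.μ 0 a).cells := by
      intro x hx
      obtain ⟨i, hi, rfl⟩ := Finset.mem_image.1 hx
      exact (P.μ 0 a).up_left_mem (Nat.le_of_lt_succ (Finset.mem_range.1 hi)) le_rfl h0
    have := Finset.card_le_card hsub
    rwa [Finset.card_image_of_injective _ (fun i j hij => (Prod.ext_iff.1 hij).1),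
      Finset.card_range] at this
  · refine lt_of_lt_of_le ?_ hle
    have hsub : (Finset.range (q + 1)).image (fun i => (p, i)) ⊆ (P.μ 0 a).cells := by
      intro x hx
      obtain ⟨i, hi, rfl⟩ := Finset.mem_image.1 hx
      exact (P.μ 0 a).up_left_mem le_rfl (Nat.le_of_lt_succ (Finset.mem_range.1 hi)) h0
    have := Finset.card_le_card hsub
    rwa [Finset.card_image_of_injective _ (fun i j hij => (Prod.ext_iff.1 hij).2),
      Finset.card_range] at this

/-- All diagrams fit into the `n 0` × `n 0` square, so a tuple is determined by finitely many
subsets of a finite set. -/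
instance : Finite (NestedPartition r n) := by
  let f : NestedPartition r n → Fin (m + 1) → Fin r → Set (Fin (n 0) × Fin (n 0)) :=
    fun P k a => {x | ((x.1 : ℕ), (x.2 : ℕ)) ∈ P.μ k a}
  refine Finite.of_injective f fun P Q h => ext_mem ?_
  have key : ∀ {P Q : NestedPartition r n}, f P = f Q → ∀ k a p q, (p, q) ∈ P.μ k a →
      (p, q) ∈ Q.μ k a := by
    intro P Q h k a p q hpq
    obtain ⟨hp, hq⟩ := P.lt_of_mem hpq
    have : (⟨p, hp⟩, ⟨q, hq⟩) ∈ f P k a := hpq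
    rwa [h] at this
  exact fun k a p q => ⟨key h k a p q, key h.symm k a p q⟩

end NestedPartition

/-! ### The monomial representation of a nested partition. -/

/-- The set of boxes of a coloured partition. -/
def ColouredPartition.boxes (μ : ColouredPartition r) : Finset (Fin r × ℕ × ℕ) :=
  (Finset.univ.sigma fun a => (μ a).cells).map (Equiv.sigmaEquivProd (Fin r) (ℕ × ℕ)).toEmbedding

theorem ColouredPartition.mem_boxes {μ : ColouredPartition r} {b : Fin r × ℕ × ℕ} :
    b ∈ μ.boxes ↔ b.2 ∈ μ b.1 := by
  rw [boxes, Finset.mem_map_equiv, Finset.mem_sigma]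
  simp

theorem ColouredPartition.card_boxes (μ : ColouredPartition r) : μ.boxes.card = μ.size := by
  simp [boxes, size, YoungDiagram.card]

theorem ColouredPartition.boxes_mono {μ ν : ColouredPartition r} (h : μ ≤ ν) :
    μ.boxes ⊆ ν.boxes := fun b hb => by
  rw [mem_boxes] at hb ⊢
  exact h b.1 hb

namespace NestedPartition

variable (P : NestedPartition r n)

/-- The boxes labelling the basis of `V k`. -/
def basisBoxes (k : Fin (m + 1)) : Finset (Fin r × ℕ × ℕ) :=
  -- For k > 0 the space `V k` is to be the kernel of the quotient from the span of μ 0 to the span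
  -- of μ k, hence the set difference. Node 0 carries all of μ 0.
  if k = 0 then (P.μ 0).boxes else (P.μ 0).boxes \ (P.μ k).boxes

variable {P} in
theorem mem_basisBoxes {k : Fin (m + 1)} {b : Fin r × ℕ × ℕ} :
    b ∈ P.basisBoxes k ↔ b ∈ (P.μ 0).boxes ∧ (k = 0 ∨ b ∉ (P.μ k).boxes) := by
  unfold basisBoxes
  split_ifs with h <;> simp [h]

theorem card_basisBoxes (k : Fin (m + 1)) : (P.basisBoxes k).card = n k := by
  cases k using Fin.cases with
  | zero => rw [basisBoxes, if_pos rfl, ColouredPartition.card_boxes, P.size_zero]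
  | succ i =>
    have := P.size_succ i
    rw [basisBoxes, if_neg (Fin.succ_ne_zero i), Finset.card_sdiff_of_subset
      (ColouredPartition.boxes_mono (P.le_zero i)), ColouredPartition.card_boxes,
      ColouredPartition.card_boxes, P.size_zero]
    omega

theorem basisBoxes_succ_subset (i : Fin m) :
    P.basisBoxes i.succ ⊆ P.basisBoxes i.castSucc := by
  intro b hb
  rw [mem_basisBoxes] at hb ⊢
  -- Monotonicity of the μ is available only between successor indices, so `i.castSucc = 0`, where
  -- there is nothing to check, is split off.
  refine ⟨hb.1, or_iff_not_imp_left.2 fun h0 h => ?_⟩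
  obtain ⟨j, hj⟩ := Fin.exists_succ_eq.2 h0
  rw [← hj] at h
  have hji : j ≤ i := by
    rw [← Fin.succ_le_succ_iff, hj]
    exact Fin.castSucc_lt_succ.le
  exact hb.2.resolve_left (Fin.succ_ne_zero i) (ColouredPartition.boxes_mono (P.mono j i hji) h)

/-- The numbering of the basis boxes. -/
def box (k : Fin (m + 1)) (i : Fin (n k)) : Fin r × ℕ × ℕ :=
  ((Finset.equivFinOfCardEq (P.card_basisBoxes k)).symm i).1

theorem box_injective (k : Fin (m + 1)) : Function.Injective (P.box k) :=
  Subtype.val_injective.comp (Equiv.injective _)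

theorem box_mem (k : Fin (m + 1)) (i : Fin (n k)) : P.box k i ∈ P.basisBoxes k :=
  ((Finset.equivFinOfCardEq (P.card_basisBoxes k)).symm i).2

variable {P} in
theorem exists_box_eq {k : Fin (m + 1)} {b : Fin r × ℕ × ℕ} (hb : b ∈ P.basisBoxes k) :
    ∃ i, P.box k i = b :=
  ⟨Finset.equivFinOfCardEq (P.card_basisBoxes k) ⟨b, hb⟩, by simp [box]⟩

/-- The basis vector of `V k` attached to a box, or zero. -/
def basisVec (k : Fin (m + 1)) (b : Fin r × ℕ × ℕ) : Fin (n k) → ℂ :=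
  fun i => if P.box k i = b then 1 else 0

theorem basisVec_box (k : Fin (m + 1)) (i : Fin (n k)) :
    P.basisVec k (P.box k i) = Pi.single i 1 := by
  ext j
  simp [basisVec, (P.box_injective k).eq_iff, Pi.single_apply]

variable {P} in
theorem basisVec_eq_zero {k : Fin (m + 1)} {b : Fin r × ℕ × ℕ} (hb : b ∉ P.basisBoxes k) :
    P.basisVec k b = 0 := by
  ext j
  exact if_neg fun h : P.box k j = b => hb (h ▸ P.box_mem k j)

/-- The matrix of the map `V l → V k` given on basis vectors by a map of boxes. -/
def boxMatrix (k l : Fin (m + 1)) (f : Fin r × ℕ × ℕ → Fin r × ℕ × ℕ) :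
    Matrix (Fin (n k)) (Fin (n l)) ℂ :=
  Matrix.of fun i j => P.basisVec k (f (P.box l j)) i

/-- The hypothesis says that a box outside the basis, whose vector is zero, is not mapped back to a
basis box. -/
theorem boxMatrix_mulVec_basisVec (k l : Fin (m + 1)) (f : Fin r × ℕ × ℕ → Fin r × ℕ × ℕ)
    (b : Fin r × ℕ × ℕ) (h : b ∉ P.basisBoxes l → f b ∉ P.basisBoxes k) :
    P.boxMatrix k l f *ᵥ P.basisVec l b = P.basisVec k (f b) := by
  by_cases hb : b ∈ P.basisBoxes l
  · obtain ⟨j, rfl⟩ := exists_box_eq hb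
    rw [basisVec_box, Matrix.mulVec_single_one]
    rfl
  · rw [basisVec_eq_zero hb, basisVec_eq_zero (h hb), Matrix.mulVec_zero]

theorem boxMatrix_mul (k l q : Fin (m + 1)) (f g : Fin r × ℕ × ℕ → Fin r × ℕ × ℕ)
    (h : ∀ b ∈ P.basisBoxes q, g b ∉ P.basisBoxes l → f (g b) ∉ P.basisBoxes k) :
    P.boxMatrix k l f * P.boxMatrix l q g = P.boxMatrix k q (f ∘ g) := by
  ext i j
  exact congrFun (P.boxMatrix_mulVec_basisVec k l f (g (P.box q j)) (h _ (P.box_mem q j))) i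

/-- The shift of boxes in the first direction. -/
def shift₁ (b : Fin r × ℕ × ℕ) : Fin r × ℕ × ℕ := (b.1, b.2.1 + 1, b.2.2)

/-- The shift of boxes in the second direction. -/
def shift₂ (b : Fin r × ℕ × ℕ) : Fin r × ℕ × ℕ := (b.1, b.2.1, b.2.2 + 1)

theorem mem_boxes_of_shift₁ {μ : ColouredPartition r} {b : Fin r × ℕ × ℕ}
    (h : shift₁ b ∈ μ.boxes) : b ∈ μ.boxes := by
  rw [ColouredPartition.mem_boxes] at h ⊢
  exact (μ b.1).up_left_mem (Nat.le_succ _) le_rfl h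

theorem mem_boxes_of_shift₂ {μ : ColouredPartition r} {b : Fin r × ℕ × ℕ}
    (h : shift₂ b ∈ μ.boxes) : b ∈ μ.boxes := by
  rw [ColouredPartition.mem_boxes] at h ⊢
  exact (μ b.1).up_left_mem le_rfl (Nat.le_succ _) h

variable {P} in
-- The complement of a diagram is stable under shifts, so a shifted box can leave the basis of `V k`
-- only by leaving μ 0. It then cannot come back under further shifts, which lets `boxMatrix_mul`
-- apply.
theorem shift₁_notMem {k : Fin (m + 1)} {b : Fin r × ℕ × ℕ} (hb : b ∈ P.basisBoxes k)
    (h : shift₁ b ∉ P.basisBoxes k) : shift₁ b ∉ (P.μ 0).boxes := fun h' =>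
  h (mem_basisBoxes.2 ⟨h', (mem_basisBoxes.1 hb).2.imp_right fun hn hm =>
    hn (mem_boxes_of_shift₁ hm)⟩)

variable {P} in
theorem shift₂_notMem {k : Fin (m + 1)} {b : Fin r × ℕ × ℕ} (hb : b ∈ P.basisBoxes k)
    (h : shift₂ b ∉ P.basisBoxes k) : shift₂ b ∉ (P.μ 0).boxes := fun h' =>
  h (mem_basisBoxes.2 ⟨h', (mem_basisBoxes.1 hb).2.imp_right fun hn hm =>
    hn (mem_boxes_of_shift₂ hm)⟩)

/-- The monomial representation attached to a nested coloured partition. -/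
def rep : Rep r n where
  B₁ k := P.boxMatrix k k shift₁
  B₂ k := P.boxMatrix k k shift₂
  I := Matrix.of fun i a => P.basisVec 0 (a, 0, 0) i
  J := 0
  F i := P.boxMatrix i.castSucc i.succ id

theorem rep_B₁_mul_B₂ (k : Fin (m + 1)) :
    P.rep.B₁ k * P.rep.B₂ k = P.rep.B₂ k * P.rep.B₁ k := by
  change P.boxMatrix k k shift₁ * P.boxMatrix k k shift₂ =
    P.boxMatrix k k shift₂ * P.boxMatrix k k shift₁
  rw [boxMatrix_mul, boxMatrix_mul]
  · rfl
  · exact fun b hb h h' =>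
      shift₁_notMem hb h (mem_boxes_of_shift₂ (mem_basisBoxes.1 h').1)
  · exact fun b hb h h' =>
      shift₂_notMem hb h (mem_boxes_of_shift₁ (mem_basisBoxes.1 h').1)

theorem rep_relations : P.rep.Relations where
  adhm := by
    rw [rep_B₁_mul_B₂, sub_self, zero_add]
    exact Matrix.mul_zero _
  comm i := by rw [rep_B₁_mul_B₂, sub_self]
  b₁F i := by
    change P.boxMatrix _ _ shift₁ * P.boxMatrix _ _ id -
      P.boxMatrix _ _ id * P.boxMatrix _ _ shift₁ = 0
    rw [boxMatrix_mul, boxMatrix_mul]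
    · exact sub_self _
    · exact fun b hb h h' => shift₁_notMem hb h (mem_basisBoxes.1 h').1
    · exact fun b hb h => absurd (P.basisBoxes_succ_subset i hb) h
  b₂F i := by
    change P.boxMatrix _ _ shift₂ * P.boxMatrix _ _ id -
      P.boxMatrix _ _ id * P.boxMatrix _ _ shift₂ = 0
    rw [boxMatrix_mul, boxMatrix_mul]
    · exact sub_self _
    · exact fun b hb h h' => shift₂_notMem hb h (mem_basisBoxes.1 h').1
    · exact fun b hb h => absurd (P.basisBoxes_succ_subset i hb) h
  jF h v := Matrix.zero_mulVec _

theorem basisBoxes_subset_zero (k : Fin (m + 1)) : P.basisBoxes k ⊆ P.basisBoxes 0 :=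
  fun _ hb => mem_basisBoxes.2 ⟨(mem_basisBoxes.1 hb).1, Or.inl rfl⟩

theorem rep_toV₀ (k : Fin (m + 1)) : P.rep.toV₀ k = P.boxMatrix 0 k id := by
  induction k using Fin.induction with
  | zero =>
    ext i j
    simp [boxMatrix, basisVec_box, Matrix.one_apply, Pi.single_apply]
  | succ i ih =>
    rw [Rep.toV₀_succ, ih]
    exact P.boxMatrix_mul _ _ _ id id fun b hb h => absurd (P.basisBoxes_succ_subset i hb) h

theorem rep_boxVec (b : Fin r × ℕ × ℕ) : P.rep.boxVec b = P.basisVec 0 b := by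
  obtain ⟨a, p, q⟩ := b
  induction p with
  | zero =>
    induction q with
    | zero =>
      rw [Rep.boxVec_zero, Matrix.mulVec_single_one]
      rfl
    | succ q ih =>
      rw [← Rep.B₂_mulVec_boxVec (P.rep_B₁_mul_B₂ 0), ih]
      refine P.boxMatrix_mulVec_basisVec 0 0 shift₂ _ fun h h' => h ?_
      exact mem_basisBoxes.2 ⟨mem_boxes_of_shift₂ (mem_basisBoxes.1 h').1, Or.inl rfl⟩
  | succ p ih =>
    rw [← Rep.B₁_mulVec_boxVec, ih]
    refine P.boxMatrix_mulVec_basisVec 0 0 shift₁ _ fun h h' => h ?_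
    exact mem_basisBoxes.2 ⟨mem_boxes_of_shift₁ (mem_basisBoxes.1 h').1, Or.inl rfl⟩

theorem eq_sum_basisVec (k : Fin (m + 1)) (v : Fin (n k) → ℂ) :
    v = ∑ i, v i • P.basisVec k (P.box k i) := by
  simp only [basisVec_box]
  exact pi_eq_sum_univ' v

theorem rep_isGenerated : P.rep.IsGenerated := by
  intro S h₁ h₂ hI
  have hbox : ∀ b, P.rep.boxVec b ∈ S := by
    rintro ⟨a, p, q⟩
    induction p with
    | zero =>
      induction q with
      | zero => rw [Rep.boxVec_zero]; exact hI _
      | succ q ih => rw [← Rep.B₂_mulVec_boxVec (P.rep_B₁_mul_B₂ 0)]; exact h₂ _ ih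
    | succ p ih => rw [← Rep.B₁_mulVec_boxVec]; exact h₁ _ ih
  refine (Submodule.eq_top_iff').2 fun v => ?_
  rw [P.eq_sum_basisVec 0 v]
  exact sum_mem fun i _ => S.smul_mem _ (P.rep_boxVec _ ▸ hbox _)

theorem boxMatrix_id_mulVec_apply (k : Fin (m + 1)) (v : Fin (n k) → ℂ) (i : Fin (n 0)) :
    (P.boxMatrix 0 k id *ᵥ v) i = ∑ j, if P.box 0 i = P.box k j then v j else 0 := by
  simp [boxMatrix, basisVec, Matrix.mulVec, dotProduct]

theorem rep_injectsInV₀ : P.rep.InjectsInV₀ := by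
  intro k v w hvw
  rw [rep_toV₀] at hvw
  have key : ∀ (v : Fin (n k) → ℂ) (i : Fin (n 0)) (j : Fin (n k)), P.box 0 i = P.box k j →
      (P.boxMatrix 0 k id *ᵥ v) i = v j := by
    intro v i j hij
    rw [boxMatrix_id_mulVec_apply, Finset.sum_eq_single j]
    · rw [if_pos hij]
    · exact fun j' _ hne => if_neg fun h => hne (P.box_injective k (h.symm.trans hij))
    · exact fun h => absurd (Finset.mem_univ j) h
  ext j
  obtain ⟨i, hi⟩ := exists_box_eq (P.basisBoxes_subset_zero k (P.box_mem k j))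
  rw [← key v i j hi, ← key w i j hi]
  exact congrFun hvw i

/-- The image of `V k` is the coordinate subspace spanned by the boxes outside μ k. The statement
also covers k = 0, since every basis box of `V 0` lies in μ 0. -/
theorem mem_rep_imageInV₀ {k : Fin (m + 1)} {v : Fin (n 0) → ℂ} :
    v ∈ P.rep.imageInV₀ k ↔ ∀ i, P.box 0 i ∈ (P.μ k).boxes → v i = 0 := by
  cases k using Fin.cases with
  | zero =>
    rw [Rep.imageInV₀_zero, Submodule.mem_bot]
    exact ⟨fun h i _ => congrFun h i, fun h => funext fun i =>
      h i (mem_basisBoxes.1 (P.box_mem 0 i)).1⟩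
  | succ l =>
    rw [Rep.imageInV₀_succ, rep_toV₀]
    constructor
    · rintro ⟨u, rfl⟩ i hi
      rw [Matrix.mulVecLin_apply, boxMatrix_id_mulVec_apply]
      refine Finset.sum_eq_zero fun j _ => if_neg fun h => ?_
      exact (mem_basisBoxes.1 (P.box_mem l.succ j)).2.resolve_left (Fin.succ_ne_zero l) (h ▸ hi)
    · intro h
      rw [P.eq_sum_basisVec 0 v]
      refine sum_mem fun i _ => ?_
      by_cases hi : P.box 0 i ∈ (P.μ l.succ).boxes
      · rw [h i hi, zero_smul]
        exact zero_mem _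
      · refine Submodule.smul_mem _ _ ⟨P.basisVec l.succ (P.box 0 i), ?_⟩
        refine P.boxMatrix_mulVec_basisVec 0 l.succ id _ fun h' => absurd ?_ h'
        exact mem_basisBoxes.2 ⟨(mem_basisBoxes.1 (P.box_mem 0 i)).1, Or.inr hi⟩

theorem rep_boxVec_mem_imageInV₀ (k : Fin (m + 1)) (b : Fin r × ℕ × ℕ) :
    P.rep.boxVec b ∈ P.rep.imageInV₀ k ↔ b ∉ (P.μ k).boxes := by
  rw [rep_boxVec, mem_rep_imageInV₀]
  constructor
  · intro h hb
    obtain ⟨i, hi⟩ := exists_box_eq (P := P) (k := 0) (b := b)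
      (mem_basisBoxes.2 ⟨ColouredPartition.boxes_mono (P.μ_le_zero k) hb, Or.inl rfl⟩)
    have := h i (hi ▸ hb)
    simp [basisVec, hi] at this
  · exact fun hb i hi => if_neg fun h : P.box 0 i = b => hb (h ▸ hi)

/-- The monomial vectors are zero or distinct basis vectors, and the subspaces are coordinate
subspaces, so membership is tested one coefficient at a time. -/
theorem rep_isMonomial : P.rep.IsMonomial where
  J_eq_zero := rfl
  smul_mem k c hc b := by
    rw [mem_rep_imageInV₀] at hc ⊢
    intro i hi
    have h1 := hc i hi
    rw [Finsupp.linearCombination_apply, Finsupp.sum, Finset.sum_apply] at h1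
    simp only [rep_boxVec, basisVec, Pi.smul_apply, smul_eq_mul, mul_ite, mul_one, mul_zero,
      Finset.sum_ite_eq] at h1 ⊢
    split_ifs with hib
    · subst hib
      by_contra h0
      rw [if_pos (Finsupp.mem_support_iff.2 h0)] at h1
      exact h0 h1
    · rfl

end NestedPartition

/-! ### An open condition bounding the diagrams from below. -/

namespace Rep

theorem continuous_entries : Continuous (entries : Rep r n → _) := continuous_induced_dom

theorem continuous_B₁ (k : Fin (m + 1)) : Continuous fun X : Rep r n => X.B₁ k :=
  (continuous_apply k).comp continuous_entries.fst

theorem continuous_B₂ (k : Fin (m + 1)) : Continuous fun X : Rep r n => X.B₂ k :=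
  (continuous_apply k).comp continuous_entries.snd.fst

theorem continuous_I : Continuous fun X : Rep r n => X.I := continuous_entries.snd.snd.fst

theorem continuous_J : Continuous fun X : Rep r n => X.J := continuous_entries.snd.snd.snd.fst

theorem continuous_F (i : Fin m) : Continuous fun X : Rep r n => X.F i :=
  (continuous_apply i).comp continuous_entries.snd.snd.snd.snd

theorem continuous_gauge_smul (g : Gauge n) : Continuous fun X : Rep r n => g • X := by
  refine continuous_induced_rng.2 (Continuous.prodMk (continuous_pi fun k => ?_) <|
    Continuous.prodMk (continuous_pi fun k => ?_) <| Continuous.prodMk ?_ <|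
    Continuous.prodMk ?_ <| continuous_pi fun i => ?_)
  · exact (continuous_const.matrix_mul (continuous_B₁ k)).matrix_mul continuous_const
  · exact (continuous_const.matrix_mul (continuous_B₂ k)).matrix_mul continuous_const
  · exact continuous_const.matrix_mul continuous_I
  · exact continuous_J.matrix_mul continuous_const
  · exact (continuous_const.matrix_mul (continuous_F i)).matrix_mul continuous_const

theorem continuous_toV₀ (k : Fin (m + 1)) : Continuous fun X : Rep r n => X.toV₀ k := by
  induction k using Fin.induction with
  | zero => exact continuous_const
  | succ i ih => exact ih.matrix_mul (continuous_F i)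

theorem continuous_boxVec (b : Fin r × ℕ × ℕ) : Continuous fun X : Rep r n => X.boxVec b :=
  ((((continuous_B₁ 0).pow b.2.1).matrix_mul ((continuous_B₂ 0).pow b.2.2)).matrix_mul
    continuous_I).matrix_mulVec continuous_const

/-- The representations whose monomial vectors at the boxes of `P.μ k` are linearly independent
modulo the image of `V k`, for all `k`. -/
def independenceLocus (P : NestedPartition r n) : Set (Rep r n) :=
  {Z | LinearIndependent ℂ fun b : {b // b ∈ (P.μ 0).boxes} => Z.boxVec b} ∩
    ⋂ i : Fin m, {Z | LinearIndependent ℂ (Sum.elim (Z.toV₀ i.succ).col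
      fun b : {b // b ∈ (P.μ i.succ).boxes} => Z.boxVec b)}

/-- Independence modulo the image of `V k` is encoded as joint independence with the columns of
`toV₀ k`. This turns a condition on a varying subspace into an open condition on finitely many
continuous vectors. -/
theorem isOpen_independenceLocus (P : NestedPartition r n) : IsOpen (independenceLocus P) := by
  refine IsOpen.inter ?_ (isOpen_iInter_of_finite fun i => ?_)
  · refine isOpen_setOfPred_linearIndependent.preimage (f := fun (Z : Rep r n)
      (b : {b // b ∈ (P.μ 0).boxes}) => Z.boxVec b) ?_
    exact continuous_pi fun b => continuous_boxVec _
  · refine isOpen_setOfPred_linearIndependent.preimage (f := fun Z : Rep r n =>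
      Sum.elim (Z.toV₀ i.succ).col fun b : {b // b ∈ (P.μ i.succ).boxes} => Z.boxVec b) ?_
    refine continuous_pi fun x => ?_
    cases x with
    | inl j =>
      exact continuous_pi fun l => (continuous_toV₀ i.succ).matrix_elem l j
    | inr b => exact continuous_boxVec _

/-- Throughout the locus the diagrams contain those of `P`: they can grow but not shrink. -/
theorem boxVec_notMem_of_mem_independenceLocus {P : NestedPartition r n} {Z : Rep r n}
    (hZ : Z ∈ independenceLocus P) (k : Fin (m + 1)) {b : Fin r × ℕ × ℕ}
    (hb : b ∈ (P.μ k).boxes) : Z.boxVec b ∉ Z.imageInV₀ k := by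
  cases k using Fin.cases with
  | zero =>
    rw [imageInV₀_zero, Submodule.mem_bot]
    exact hZ.1.ne_zero (⟨b, hb⟩ : {b // b ∈ (P.μ 0).boxes})
  | succ i =>
    have h := linearIndependent_sum.1 (Set.mem_iInter.1 hZ.2 i)
    intro hmem
    rw [imageInV₀_succ, Matrix.range_mulVecLin] at hmem
    refine h.2.1.ne_zero (⟨b, hb⟩ : {b // b ∈ (P.μ i.succ).boxes}) ?_
    exact Submodule.disjoint_def.1 h.2.2 _ hmem (Submodule.subset_span ⟨⟨b, hb⟩, rfl⟩)

theorem IsMonomial.mem_independenceLocus {P : NestedPartition r n} {X : Rep r n}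
    (hX : X.IsMonomial) (hi : X.InjectsInV₀)
    (hP : ∀ k, ∀ b ∈ (P.μ k).boxes, X.boxVec b ∉ X.imageInV₀ k) : X ∈ independenceLocus P := by
  have hli : ∀ k, LinearIndependent ℂ fun b : {b // b ∈ (P.μ k).boxes} =>
      (X.imageInV₀ k).mkQ (X.boxVec b) := fun k =>
    (hX.linearIndependent k).comp
      (fun b : {b // b ∈ (P.μ k).boxes} => ⟨b.1, hP k b.1 b.2⟩) fun b b' h =>
        Subtype.ext (Subtype.mk.inj h)
  refine ⟨LinearIndependent.of_comp _ (hli 0), Set.mem_iInter.2 fun i => ?_⟩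
  have hcol : ∀ j, (X.toV₀ i.succ).col j ∈ X.imageInV₀ i.succ := fun j => by
    rw [imageInV₀_succ, Matrix.range_mulVecLin]
    exact Submodule.subset_span ⟨j, rfl⟩
  exact LinearIndependent.sumElim_of_quotient (M' := X.imageInV₀ i.succ)
    (f := fun j => ⟨(X.toV₀ i.succ).col j, hcol j⟩)
    (LinearIndependent.of_comp (X.imageInV₀ i.succ).subtype
      (Matrix.mulVec_injective_iff.1 (hi i.succ))) _ (hli i.succ)

end Rep

/-! ### The fixed locus in the moduli space. -/

theorem mk_eq_mk_iff {X Y : StableRep r n θ} :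
    Moduli.mk X = Moduli.mk Y ↔ ∃ g : Gauge n, g • X.1 = Y.1 := by
  exact ⟨fun h => Quotient.exact h.symm, fun h => (Quotient.sound (s := gaugeSetoid r n θ) h).symm⟩

theorem compactFixedLocus_isCompactFixed {X : StableRep r n θ}
    (h : Moduli.mk X ∈ compactFixedLocus r n θ) : X.1.IsCompactFixed := fun t ht =>
  mk_eq_mk_iff.1 (h ⟨t, ht⟩).symm

theorem mem_fixedLocus_of_isMonomial (hθ : θ ∈ Chamber n) {X : StableRep r n θ}
    (h : X.1.IsMonomial) : Moduli.mk X ∈ fixedLocus r n θ := fun t =>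
  (mk_eq_mk_iff.2 (h.exists_gauge_smul_eq_torus_smul X.2.1 (X.2.2.injectsInV₀ hθ X.2.1)
    (X.2.2.isGenerated hθ X.2.1)
    (fun t => (X.2.2.torus_smul t).isGenerated hθ (X.2.1.torus_smul t)) t)).symm

theorem fixedLocus_subset : fixedLocus r n θ ⊆ compactFixedLocus r n θ := fun _ hp t => hp t

theorem isMonomial_of_mem_compactFixedLocus (hθ : θ ∈ Chamber n) {X : StableRep r n θ}
    (h : Moduli.mk X ∈ compactFixedLocus r n θ) : X.1.IsMonomial :=
  (compactFixedLocus_isCompactFixed h).isMonomial (X.2.2.isGenerated hθ X.2.1)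

theorem isMonomial_of_mem_fixedLocus (hθ : θ ∈ Chamber n) {X : StableRep r n θ}
    (h : Moduli.mk X ∈ fixedLocus r n θ) : X.1.IsMonomial :=
  isMonomial_of_mem_compactFixedLocus hθ (fixedLocus_subset h)

theorem compactFixedLocus_eq_fixedLocus (hθ : θ ∈ Chamber n) :
    compactFixedLocus r n θ = fixedLocus r n θ := by
  refine Set.Subset.antisymm (fun p hp => ?_) fixedLocus_subset
  obtain ⟨X, rfl⟩ := Quotient.exists_rep p
  exact mem_fixedLocus_of_isMonomial hθ (isMonomial_of_mem_compactFixedLocus hθ hp)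

/-- A nested coloured partition describes a representation if it records which monomial vectors
vanish modulo the subspaces `imageInV₀ k`. -/
def Describes (P : NestedPartition r n) (X : Rep r n) : Prop :=
  ∀ k a p q, (p, q) ∈ P.μ k a ↔ X.boxVec (a, p, q) ∉ X.imageInV₀ k

theorem Describes.gauge_smul {P : NestedPartition r n} {X : Rep r n} (h : Describes P X)
    (g : Gauge n) : Describes P (g • X) := fun k a p q => by
  rw [h, Rep.boxVec_mem_imageInV₀_gauge_smul]

theorem mk_eq_mk_of_describes (hθ : θ ∈ Chamber n) {P : NestedPartition r n}
    {X Y : StableRep r n θ} (hX : Moduli.mk X ∈ fixedLocus r n θ)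
    (hY : Moduli.mk Y ∈ fixedLocus r n θ) (dX : Describes P X.1) (dY : Describes P Y.1) :
    Moduli.mk X = Moduli.mk Y :=
  mk_eq_mk_iff.2 <| (isMonomial_of_mem_fixedLocus hθ hX).exists_gauge_smul_eq
    (isMonomial_of_mem_fixedLocus hθ hY) X.2.1 Y.2.1 (X.2.2.injectsInV₀ hθ X.2.1)
    (Y.2.2.injectsInV₀ hθ Y.2.1) (X.2.2.isGenerated hθ X.2.1) (Y.2.2.isGenerated hθ Y.2.1)
    fun k ⟨a, p, q⟩ => not_iff_not.1 ((dX k a p q).symm.trans (dY k a p q))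

theorem exists_describes (hθ : θ ∈ Chamber n) {X : StableRep r n θ}
    (hX : Moduli.mk X ∈ fixedLocus r n θ) : ∃ P, Describes P X.1 :=
  (isMonomial_of_mem_fixedLocus hθ hX).exists_nestedPartition X.2.1 (X.2.2.isGenerated hθ X.2.1)
    (X.2.2.injectsInV₀ hθ X.2.1)

theorem exists_fixed_describes (hθ : θ ∈ Chamber n) (P : NestedPartition r n) :
    ∃ X : StableRep r n θ, Moduli.mk X ∈ fixedLocus r n θ ∧ Describes P X.1 := by
  refine ⟨⟨P.rep, P.rep_relations, Rep.isStable_of_injectsInV₀_of_isGenerated hθ P.rep_injectsInV₀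
    P.rep_isGenerated⟩, mem_fixedLocus_of_isMonomial hθ P.rep_isMonomial, fun k a p q => ?_⟩
  rw [P.rep_boxVec_mem_imageInV₀, not_not, ColouredPartition.mem_boxes]

/-- The sizes are prescribed by `n`, so no inclusion can be strict. -/
theorem NestedPartition.eq_of_le {P Q : NestedPartition r n} (h : ∀ k, P.μ k ≤ Q.μ k) : P = Q := by
  have hsize : ∀ k, (P.μ k).size = (Q.μ k).size := by
    intro k
    cases k using Fin.cases with
    | zero => rw [P.size_zero, Q.size_zero]
    | succ i =>
      have h1 := P.size_succ i
      have h2 := Q.size_succ i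
      omega
  have hboxes : ∀ k, (P.μ k).boxes = (Q.μ k).boxes := fun k =>
    Finset.eq_of_subset_of_card_le (ColouredPartition.boxes_mono (h k)) (by
      rw [ColouredPartition.card_boxes, ColouredPartition.card_boxes, hsize])
  refine ext_mem fun k a p q => ?_
  have := Finset.ext_iff.1 (hboxes k) (a, p, q)
  rwa [ColouredPartition.mem_boxes, ColouredPartition.mem_boxes] at this

/-- The classes meeting the independence locus of `P` form an open neighbourhood. A fixed class in
it has diagrams containing those of `P`, hence equal to them, and so is the given point. -/
theorem discreteTopology_fixedLocus (hθ : θ ∈ Chamber n) :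
    DiscreteTopology (fixedLocus r n θ) := by
  refine discreteTopology_subtype_iff'.2 fun p hp => ?_
  obtain ⟨X, rfl⟩ := Quotient.exists_rep p
  obtain ⟨P, hP⟩ := exists_describes hθ hp
  let V : Set (Moduli r n θ) :=
    {p | ∃ Z : StableRep r n θ, Moduli.mk Z = p ∧ ∃ g : Gauge n, g • Z.1 ∈ Rep.independenceLocus P}
  refine ⟨V, ?_, Set.Subset.antisymm ?_ ?_⟩
  · refine isQuotientMap_quot_mk.isOpen_preimage.1 ?_
    -- The preimage in the space of stable representations is the gauge saturation of an open set, a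
    -- union of preimages under the continuous maps given by single gauge elements.
    have hV : Quot.mk _ ⁻¹' V =
        ⋃ g : Gauge n, {Z : StableRep r n θ | g • Z.1 ∈ Rep.independenceLocus P} := by
      ext Z
      rw [Set.mem_iUnion]
      constructor
      · rintro ⟨Z', hZ', g, hg⟩
        obtain ⟨g', hg'⟩ := mk_eq_mk_iff.1 (hZ' : Moduli.mk Z' = Moduli.mk Z).symm
        refine ⟨g * g', ?_⟩
        rwa [Set.mem_ofPred_eq, mul_smul, hg']
      · rintro ⟨g, hg⟩
        exact ⟨Z, rfl, g, hg⟩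
    rw [hV]
    exact isOpen_iUnion fun g => (Rep.isOpen_independenceLocus P).preimage
      ((Rep.continuous_gauge_smul g).comp continuous_subtype_val)
  · rintro q ⟨⟨Y, rfl, g, hg⟩, hY⟩
    obtain ⟨Q, hQ⟩ := exists_describes hθ hY
    have hPQ : P = Q := NestedPartition.eq_of_le fun k a ⟨x, y⟩ hx => by
      rw [hQ.gauge_smul g]
      exact Rep.boxVec_notMem_of_mem_independenceLocus hg k (ColouredPartition.mem_boxes.2 hx)
    subst hPQ
    exact mk_eq_mk_of_describes hθ hY hp hQ hP
  · rintro _ rfl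
    refine ⟨⟨X, rfl, 1, ?_⟩, hp⟩
    rw [one_smul]
    refine (isMonomial_of_mem_fixedLocus hθ hp).mem_independenceLocus (X.2.2.injectsInV₀ hθ X.2.1)
      fun k b hb => ?_
    exact (hP k b.1 b.2.1 b.2.2).1 (ColouredPartition.mem_boxes.1 hb)

theorem exists_equiv_nestedPartition (hθ : θ ∈ Chamber n) :
    ∃ Φ : fixedLocus r n θ ≃ NestedPartition r n,
      ∀ (X : StableRep r n θ) (hX : Moduli.mk X ∈ fixedLocus r n θ),
        Describes (Φ ⟨Moduli.mk X, hX⟩) X.1 := by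
  -- The tuple is required to describe every representative at once, which gauge invariance permits,
  -- so the chosen map can be evaluated on any `X`.
  have h : ∀ p : fixedLocus r n θ, ∃ P : NestedPartition r n,
      ∀ X : StableRep r n θ, Moduli.mk X = p → Describes P X.1 := by
    rintro ⟨p, hp⟩
    obtain ⟨X, rfl⟩ := Quotient.exists_rep p
    obtain ⟨P, hP⟩ := exists_describes hθ hp
    refine ⟨P, fun Y hY => ?_⟩
    obtain ⟨g, hg⟩ := mk_eq_mk_iff.1 (hY : Moduli.mk Y = Moduli.mk X).symm
    exact hg ▸ hP.gauge_smul g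
  choose Φ hΦ using h
  refine ⟨Equiv.ofBijective Φ ⟨?_, fun P => ?_⟩, fun X hX => hΦ ⟨_, hX⟩ X rfl⟩
  · rintro ⟨p, hp⟩ ⟨q, hq⟩ hpq
    obtain ⟨X, rfl⟩ := Quotient.exists_rep p
    obtain ⟨Y, rfl⟩ := Quotient.exists_rep q
    exact Subtype.ext (mk_eq_mk_of_describes hθ hp hq (hΦ ⟨_, hp⟩ X rfl)
      (hpq ▸ hΦ ⟨_, hq⟩ Y rfl))
  · obtain ⟨X, hX, hP⟩ := exists_fixed_describes hθ P
    refine ⟨⟨_, hX⟩, NestedPartition.ext_mem fun k a p q => ?_⟩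
    rw [hΦ ⟨_, hX⟩ X rfl, hP]

end NestedInstanton
end

open NestedInstanton

theorem mainTheorem1 (r m : ℕ) (n : Fin (m + 1) → ℕ) (θ : Fin (m + 1) → ℝ)
    (hθ : θ ∈ Chamber n) :
    (fixedLocus r n θ).Finite ∧ DiscreteTopology (fixedLocus r n θ) ∧
    compactFixedLocus r n θ = fixedLocus r n θ ∧
    ∃ Φ : fixedLocus r n θ ≃ NestedPartition r n,
      ∀ (X : StableRep r n θ) (hX : Moduli.mk X ∈ fixedLocus r n θ)
        (k : Fin (m + 1)) (a : Fin r) (i j : ℕ),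
        (i, j) ∈ (Φ ⟨Moduli.mk X, hX⟩).μ k a ↔ X.1.monomialVec a i j ∉ X.1.imageInV₀ k := by
  obtain ⟨Φ, hΦ⟩ := exists_equiv_nestedPartition (r := r) hθ
  exact ⟨Set.finite_coe_iff.1 (Finite.of_equiv _ Φ.symm), discreteTopology_fixedLocus hθ,
    compactFixedLocus_eq_fixedLocus hθ, Φ, fun X hX k a i j => hΦ X hX k a i j⟩
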